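/- **Theorem 3.1.** Let $a<b$, $\Omega=(a,b)$, let $m\ge 2$ be an integer, and let $V,A_1:\Omega\to\mathbb R$ satisfy (A) $V,A_1\in W^{m,\infty}_{\rm per}(\Omega)=\{u\in W^{m,\infty}(\Omega):\ \partial_x^l u(a)=\partial_x^l u(b),\ l=0,\dots,m-1\}$. Put $\sigma_1=\begin{pmatrix}0&1\\1&0\end{pmatrix}$, $\sigma_3=\begin{pmatrix}1&0\\0&-1\end{pmatrix}$, $\mathbf T=-\sigma_1\partial_x-i\sigma_3$ (with periodic boundary conditions) and $\mathbf V=-i(V(x)I_2-A_1(x)\sigma_1)$. With $\mu_l=2\pi l/(b-a)$ and $\widehat u_l=\frac1{b-a}\int_a^b u(x)e^{-i\mu_l(x-a)}dx$, let $\|u\|_{H^m}=\big(\sum_{l\in\mathbb Z}(1+\mu_l^2)^m|\widehat u_l|^2\big)^{1/2}$; the group generated by $\mathbf T$ on $(L^2(\Omega))^2$ is $e^{t\mathbf T}u=\sum_{l\in\mathbb Z}e^{-it(\mu_l\sigma_1+\sigma_3)}\,\widehat u_l\,e^{i\mu_l(x-a)}$, and $e^{s\mathbf V}$ is multiplication by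 the matrix exponential of $s\mathbf V(x)$. Then for every $M$ there is a constant $C_1>0$, depending only on $a,b,m,V,A_1,M$, such that the following holds for all $T>0$ and $0<\varepsilon\le1$. Let $\Phi\in C([0,T/\varepsilon];(L^2(\Omega))^2)$, differentiable in $(L^2(\Omega))^2$ for $0<t<T/\varepsilon$, with $\Phi(t)\in(H^1_{\rm per}(\Omega))^2$ for these $t$, be a solution of the Dirac equation with small potentials and periodic boundary conditions $$\partial_t\Phi=(\mathbf T+\varepsilon\mathbf V)\Phi\quad(0<t<T/\varepsilon),\qquad \Phi(0)=\Phi_0,$$ and suppose that (B) $\Phi(t)\in (H^m_{\rm per}(\Omega))^2$ and $\|\Phi(t)\|_{H^m}\le M$ for almost every $t\in[0,T/\varepsilon]$, where $H^m_{\rm per}(\Omega)=\{u\in H^m(\Omega):\ \partial_x^lu(a)=\partial_x^lu(b),\ l=0,\dots,m-1\}$. For $\tau>0$ let $t_n=n\tau$, $\Phi^{[0]}=\Phi_0$ and $\Phi^{[n+1]}=e^{\frac\tau2\mathbf T}e^{\varepsilon\tau\mathbf V}e^{\frac\tau2\mathbf T}\Phi^{[n]}$. Then $$\|\Phi(t_n)-\Phi^{[n]}\|_{L^2}\le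 C_1\,\varepsilon\,t_n\,\tau^2\le C_1\,T\,\tau^2\qquad\text{for all integers } 0\le n\le\frac{T/\varepsilon}{\tau}.$$ In particular $C_1$ is independent of $\tau$, $n$ and $\varepsilon$. -/

import Mathlib

open MeasureTheory Set
open scoped ContDiff ENNReal Matrix

noncomputable section

namespace DiracSplitting

/-- Values of the wave function: `ℂ²` with the Hermitian norm. -/
abbrev Spinor : Type := EuclideanSpace ℂ (Fin 2)

/-- Lebesgue measure on the interval `Ω = (a, b)`. -/
abbrev intervalMeasure (a b : ℝ) : Measure ℝ := volume.restrict (Ioo a b)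

/-- The Hilbert space `(L²(Ω))²` with `Ω = (a, b)`. -/
abbrev L2 (a b : ℝ) : Type := Lp Spinor 2 (intervalMeasure a b)

/-! ### Periodic Sobolev spaces on an interval -/

/-- `v` is the weak derivative of `u` on `(a, b)`. -/
structure IsWeakDeriv {E : Type*} [NormedAddCommGroup E] [NormedSpace ℝ E]
    (a b : ℝ) (u v : ℝ → E) : Prop where
  locallyIntegrable : LocallyIntegrableOn u (Ioo a b) volume
  locallyIntegrable_deriv : LocallyIntegrableOn v (Ioo a b) volume
  integral_eq : ∀ φ : ℝ → ℝ, ContDiff ℝ ∞ φ → HasCompactSupport φ → tsupport φ ⊆ Ioo a b →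
    ∫ x in Ioo a b, deriv φ x • u x = -∫ x in Ioo a b, φ x • v x

/-- `D 0, …, D m` are the weak derivatives of orders `0, …, m` of the function `u`, all in
`L^p(a, b)`, where those of order `l < m` are given by their representatives that are continuous
on `[a, b]`, and these take equal values at the two end points. -/
structure IsPeriodicSobolevJet {E : Type*} [NormedAddCommGroup E] [NormedSpace ℝ E]
    (a b : ℝ) (m : ℕ) (p : ℝ≥0∞) (u : ℝ → E) (D : ℕ → ℝ → E) : Prop where
  zero : D 0 =ᵐ[intervalMeasure a b] u
  memLp : ∀ l ≤ m, MemLp (D l) p (intervalMeasure a b)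
  weakDeriv : ∀ l < m, IsWeakDeriv a b (D l) (D (l + 1))
  continuousOn : ∀ l < m, ContinuousOn (D l) (Icc a b)
  periodic : ∀ l < m, D l a = D l b

/-- Membership in `W^{m,p}_per(a, b)`: functions in `W^{m,p}(a, b)` whose derivatives of
orders `0, …, m - 1` agree at `a` and `b`. -/
def MemPeriodicSobolev {E : Type*} [NormedAddCommGroup E] [NormedSpace ℝ E]
    (a b : ℝ) (m : ℕ) (p : ℝ≥0∞) (u : ℝ → E) : Prop :=
  ∃ D : ℕ → ℝ → E, IsPeriodicSobolevJet a b m p u D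

/-! ### Fourier series on the interval -/

/-- The frequency `μ_l = 2πl/(b - a)`. -/
def freq (a b : ℝ) (l : ℤ) : ℝ := 2 * Real.pi * l / (b - a)

/-- The Fourier coefficient `(b - a)⁻¹ ∫_a^b u(x) e^{-iμ_l(x - a)} dx`. -/
def fourierCoef (a b : ℝ) (u : ℝ → Spinor) (l : ℤ) : Spinor :=
  ((1 / (b - a) : ℝ) : ℂ) •
    ∫ x in Ioo a b, Complex.exp (-(Complex.I * (freq a b l * (x - a) : ℝ))) • u x

/-- The norm `(∑_l (1 + μ_l²)^m |û_l|²)^{1/2}` on `(H^m_per(a, b))²`, as an extended real. -/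
def sobolevNorm (a b : ℝ) (m : ℕ) (u : ℝ → Spinor) : ℝ≥0∞ :=
  (∑' l : ℤ, ENNReal.ofReal ((1 + freq a b l ^ 2) ^ m * ‖fourierCoef a b u l‖ ^ 2)) ^ (1 / 2 : ℝ)

/-- The function `x ↦ e^{iμ_l(x - a)} c`. -/
def planeWave (a b : ℝ) (l : ℤ) (c : Spinor) (x : ℝ) : Spinor :=
  Complex.exp (Complex.I * (freq a b l * (x - a) : ℝ)) • c

theorem memLp_planeWave (a b : ℝ) (l : ℤ) (c : Spinor) :
    MemLp (planeWave a b l c) 2 (intervalMeasure a b) := by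
  refine MemLp.of_bound (C := ‖c‖) ?_ (Filter.Eventually.of_forall fun x => ?_)
  · have : Continuous (planeWave a b l c) := by
      unfold planeWave
      fun_prop
    exact this.aestronglyMeasurable
  · rw [planeWave, norm_smul, mul_comm Complex.I, Complex.norm_exp_ofReal_mul_I, one_mul]

/-! ### The operators of the Dirac equation -/

/-- The Pauli matrix `σ₁`. -/
def σ₁ : Matrix (Fin 2) (Fin 2) ℂ := !![0, 1; 1, 0]

/-- The Pauli matrix `σ₃`. -/
def σ₃ : Matrix (Fin 2) (Fin 2) ℂ := !![1, 0; 0, -1]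

/-- A `2 × 2` matrix applied to a vector of `ℂ²`. -/
def act (B : Matrix (Fin 2) (Fin 2) ℂ) (w : Spinor) : Spinor := WithLp.toLp 2 (B *ᵥ WithLp.ofLp w)

/-- The function `𝐓u = -σ₁ ∂ₓu - iσ₃ u`, where `du` stands for `∂ₓu`. -/
def freeOp (u du : ℝ → Spinor) (x : ℝ) : Spinor :=
  -act σ₁ (du x) - Complex.I • act σ₃ (u x)

/-- The matrix `𝐕(x) = -i(V(x) I₂ - A₁(x) σ₁)`. -/
def potentialMatrix (V A₁ : ℝ → ℝ) (x : ℝ) : Matrix (Fin 2) (Fin 2) ℂ :=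
  -Complex.I • ((V x : ℂ) • (1 : Matrix (Fin 2) (Fin 2) ℂ) - (A₁ x : ℂ) • σ₁)

/-- The Fourier symbol `Γ_l = μ_l σ₁ + σ₃` of `i𝐓`. -/
def freeSymbol (a b : ℝ) (l : ℤ) : Matrix (Fin 2) (Fin 2) ℂ :=
  (freq a b l : ℂ) • σ₁ + σ₃

/-- The unitary group generated by `𝐓` on `(L²(a, b))²` with periodic boundary conditions:
`e^{t𝐓} u = ∑_l e^{-itΓ_l} û_l e^{iμ_l(x - a)}`, the series being summed in `L²`. -/
def freeFlow (a b t : ℝ) (u : ℝ → Spinor) : ℝ → Spinor :=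
  ((∑' l : ℤ, (memLp_planeWave a b l
    (act (NormedSpace.exp (-(Complex.I * (t : ℂ)) • freeSymbol a b l))
      (fourierCoef a b u l))).toLp (planeWave a b l _) : L2 a b) : ℝ → Spinor)

/-- The operator `e^{s𝐕}`, multiplication by the matrix exponential of `s𝐕(x)`. -/
def potentialFlow (V A₁ : ℝ → ℝ) (s : ℝ) (u : ℝ → Spinor) (x : ℝ) : Spinor :=
  act (NormedSpace.exp ((s : ℂ) • potentialMatrix V A₁ x)) (u x)

/-- One step `e^{τ𝐓/2} e^{ετ𝐕} e^{τ𝐓/2}` of the Strang splitting. -/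
def strangStep (a b : ℝ) (V A₁ : ℝ → ℝ) (ε τ : ℝ) (u : ℝ → Spinor) : ℝ → Spinor :=
  freeFlow a b (τ / 2) (potentialFlow V A₁ (ε * τ) (freeFlow a b (τ / 2) u))

/-- The numerical approximation `Φ^{[n]}` obtained from `Φ^{[0]} = Φ₀`. -/
def strangApprox (a b : ℝ) (V A₁ : ℝ → ℝ) (ε τ : ℝ) (Φ₀ : ℝ → Spinor) : ℕ → ℝ → Spinor
  | 0 => Φ₀
  | n + 1 => strangStep a b V A₁ ε τ (strangApprox a b V A₁ ε τ Φ₀ n)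

/-- `Φ` is a solution on `[0, S]` of `∂ₜΦ = (𝐓 + ε𝐕)Φ` on `(a, b)` with periodic boundary
conditions and initial value `Φ₀`: a continuous curve in `(L²(a, b))²` that is differentiable for
`0 < t < S`, where `Φ(t) ∈ (H¹_per(a, b))²` and the equation holds in `(L²(a, b))²`. -/
structure IsDiracSolution (a b : ℝ) (V A₁ : ℝ → ℝ) (ε S : ℝ) (Φ₀ : L2 a b) (Φ : ℝ → L2 a b) :
    Prop where
  continuousOn : ContinuousOn Φ (Icc 0 S)
  initial : Φ 0 = Φ₀
  equation : ∀ t ∈ Ioo 0 S, ∃ (D : ℕ → ℝ → Spinor) (F : L2 a b),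
    IsPeriodicSobolevJet a b 1 2 (Φ t) D ∧
    HasDerivAt Φ F t ∧
    F =ᵐ[intervalMeasure a b] fun x =>
      freeOp (Φ t) (D 1) x + (ε : ℂ) • act (potentialMatrix V A₁ x) (Φ t x)

end DiracSplitting

end

open DiracSplitting

/-! Over one step, pass to the interaction picture Ψ(s) = e^{-s𝐓} Φ(t + s). The unbounded operator
disappears and Ψ' = εB(s)Ψ remains, where B(s) = e^{-s𝐓} P e^{s𝐓} and P is the bounded
multiplication by 𝐕 (`IsDiracSolution.interaction_sub_eq`). In the same picture a Strang step is
exp(ετB(τ/2)): it freezes B at the midpoint. Both propagators are expanded to second order. The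
first order terms differ by ε times a midpoint quadrature error for s ↦ B(s)Ψ(0), which is O(τ³);
all other discrepancies carry at least ε² and are O(τ³) as well. Since ε ≤ 1, the local error is
O(ετ³) (`norm_evolution_expansion_le`, `norm_sub_strangOp_le`). Both flows are isometric, so local
errors merely add up, and n steps give O(ε t_n τ²) (`norm_sub_strangSeq_le`).

The quadrature error is controlled by symmetric second differences of B(s)u
(`norm_integral_sub_midpoint_le`, `norm_interaction_second_difference_le`). These cost two space
derivatives of u, and H² is all the regularity that is used.

The analysis of 𝐓 takes place on Fourier coefficients. There 𝐓 is a skew-adjoint 2 × 2 matrix of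
size at most 1 + |μ_l|, e^{t𝐓} is unitary and commutes with ∂ₓ, and each power of t gained costs one
derivative. That P preserves two derivatives (`exists_potentialOp`) follows from a Leibniz rule
checked on plane waves, which rests on integration by parts without boundary terms for periodic
functions. Finally, the Sobolev bound, assumed for almost every time, extends to all times by
continuity of Φ in L² (`sobolevBound_of_ae`). -/

namespace DiracSplitting

open Filter Topology

/-! ### Integration by parts against periodic functions -/

/-- A smooth step of width `1 / n`, increasing from `0` to `1`, starting at `c`. -/
noncomputable def smoothStep (n c x : ℝ) : ℝ := Real.smoothTransition (n * (x - c))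

theorem contDiff_smoothStep (n c : ℝ) : ContDiff ℝ ∞ (smoothStep n c) := by
  unfold smoothStep
  exact Real.smoothTransition.contDiff.comp (by fun_prop)

theorem smoothStep_of_le {n c x : ℝ} (hn : 0 ≤ n) (h : x ≤ c) : smoothStep n c x = 0 :=
  Real.smoothTransition.zero_of_nonpos (mul_nonpos_of_nonneg_of_nonpos hn (by linarith))

theorem smoothStep_of_ge {n c x : ℝ} (hn : 0 < n) (h : c + 1 / n ≤ x) : smoothStep n c x = 1 := by
  apply Real.smoothTransition.one_of_one_le
  have h' : 1 / n ≤ x - c := by linarith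
  rw [div_le_iff₀ hn] at h'
  linarith

theorem monotone_smoothStep {n : ℝ} (hn : 0 ≤ n) (c : ℝ) : Monotone (smoothStep n c) :=
  fun _ _ h => Real.smoothTransition.monotone (by gcongr)

theorem smoothStep_nonneg (n c x : ℝ) : 0 ≤ smoothStep n c x := Real.smoothTransition.nonneg _

theorem smoothStep_le_one (n c x : ℝ) : smoothStep n c x ≤ 1 := Real.smoothTransition.le_one _

theorem deriv_smoothStep_eq_zero {n c x : ℝ} (hn : 0 < n) (h : x < c ∨ c + 1 / n < x) :
    deriv (smoothStep n c) x = 0 := by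
  rcases h with h | h
  · have : smoothStep n c =ᶠ[𝓝 x] fun _ => (0 : ℝ) := by
      filter_upwards [Iio_mem_nhds h] with y hy using smoothStep_of_le hn.le (le_of_lt hy)
    rw [this.deriv_eq, deriv_const]
  · have : smoothStep n c =ᶠ[𝓝 x] fun _ => (1 : ℝ) := by
      filter_upwards [Ioi_mem_nhds h] with y hy using smoothStep_of_ge hn (le_of_lt hy)
    rw [this.deriv_eq, deriv_const]

/-- A smooth function vanishing near the end points of `(a, b)` and equal to `1` at distance
`2 / n` from them. -/
noncomputable def cutoff (a b n x : ℝ) : ℝ := smoothStep n (a + 1 / n) x - smoothStep n (b - 2 / n) x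

theorem contDiff_cutoff (a b n : ℝ) : ContDiff ℝ ∞ (cutoff a b n) :=
  (contDiff_smoothStep _ _).sub (contDiff_smoothStep _ _)

theorem abs_cutoff_le_one (a b n x : ℝ) : |cutoff a b n x| ≤ 1 := by
  have h1 := smoothStep_nonneg n (a + 1 / n) x
  have h2 := smoothStep_nonneg n (b - 2 / n) x
  have h3 := smoothStep_le_one n (a + 1 / n) x
  have h4 := smoothStep_le_one n (b - 2 / n) x
  rw [cutoff, abs_le]
  constructor <;> linarith

theorem cutoff_eq_zero {a b n x : ℝ} (hn : 0 < n) (hnab : 4 / n < b - a)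
    (hx : x ∉ Icc (a + 1 / n) (b - 1 / n)) : cutoff a b n x = 0 := by
  have h0 : 4 / n = 4 * (1 / n) := by ring
  have h2 : 2 / n = 2 * (1 / n) := by ring
  have hp : 0 < 1 / n := by positivity
  rw [mem_Icc, not_and_or, not_le, not_le] at hx
  unfold cutoff
  rcases hx with hx | hx
  · rw [smoothStep_of_le hn.le hx.le, smoothStep_of_le hn.le (by linarith), sub_zero]
  · rw [smoothStep_of_ge hn (by linarith), smoothStep_of_ge hn (by linarith), sub_self]

theorem tsupport_cutoff_subset {a b n : ℝ} (hn : 0 < n) (hnab : 4 / n < b - a) :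
    tsupport (cutoff a b n) ⊆ Icc (a + 1 / n) (b - 1 / n) := by
  refine closure_minimal (fun x hx => ?_) isClosed_Icc
  by_contra h
  exact hx (cutoff_eq_zero hn hnab h)

theorem tendsto_cutoff {a b x : ℝ} (hx : x ∈ Ioo a b) :
    Tendsto (fun n : ℕ => cutoff a b n x) atTop (𝓝 1) := by
  have hlim : Tendsto (fun n : ℕ => 2 * (1 / (n : ℝ))) atTop (𝓝 0) := by
    simpa using tendsto_one_div_atTop_nhds_zero_nat.const_mul (2 : ℝ)
  refine tendsto_const_nhds.congr' ?_
  filter_upwards [hlim.eventually (gt_mem_nhds (sub_pos.2 hx.1)),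
    hlim.eventually (gt_mem_nhds (sub_pos.2 hx.2)), eventually_gt_atTop 0] with n h1 h2 h3
  have hn : (0 : ℝ) < n := by exact_mod_cast h3
  have h4 : 2 / (n : ℝ) = 2 * (1 / n) := by ring
  rw [cutoff, smoothStep_of_ge hn (by linarith), smoothStep_of_le hn.le (by linarith), sub_zero]

section

variable {E : Type*} [NormedAddCommGroup E] [NormedSpace ℝ E]

theorem tendsto_integral_cutoff_smul {a b : ℝ} {F : ℝ → E} (hF : IntegrableOn F (Ioo a b)) :
    Tendsto (fun n : ℕ => ∫ x in Ioo a b, cutoff a b n x • F x) atTop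
      (𝓝 (∫ x in Ioo a b, F x)) := by
  refine tendsto_integral_of_dominated_convergence (fun x => ‖F x‖) (fun n => ?_) hF.norm
    (fun n => Eventually.of_forall fun x => ?_) ?_
  · exact (contDiff_cutoff a b n).continuous.aestronglyMeasurable.smul hF.aestronglyMeasurable
  · rw [norm_smul, Real.norm_eq_abs]
    exact mul_le_of_le_one_left (norm_nonneg _) (abs_cutoff_le_one _ _ _ _)
  · filter_upwards [ae_restrict_mem measurableSet_Ioo] with x hx
    simpa using (tendsto_cutoff hx).smul_const (F x)

/-- The derivative of the cutoff is a unit mass concentrating at `a` minus a unit mass concentrating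
at `b`, so the limit is `G a - G b`. -/
theorem tendsto_integral_deriv_cutoff_smul [CompleteSpace E] {a b : ℝ} (hab : a < b) {G : ℝ → E}
    (hG : ContinuousOn G (Icc a b)) (hper : G a = G b) :
    Tendsto (fun n : ℕ => ∫ x in Ioo a b, deriv (cutoff a b n) x • G x) atTop (𝓝 0) := by
  have hlim : Tendsto (fun n : ℕ => 2 * (1 / (n : ℝ))) atTop (𝓝 0) := by
    simpa using tendsto_one_div_atTop_nhds_zero_nat.const_mul (2 : ℝ)
  rw [Metric.tendsto_atTop']
  intro ε hε
  obtain ⟨δ₁, hδ₁, h₁⟩ := Metric.continuousOn_iff.1 hG a (left_mem_Icc.2 hab.le) (ε / 3) (by linarith)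
  obtain ⟨δ₂, hδ₂, h₂⟩ := Metric.continuousOn_iff.1 hG b (right_mem_Icc.2 hab.le) (ε / 3)
    (by linarith)
  have hev : ∀ᶠ n : ℕ in atTop, 2 * (1 / (n : ℝ)) < δ₁ ∧ 2 * (1 / (n : ℝ)) < δ₂ ∧
      2 * (1 / (n : ℝ)) < (b - a) / 2 ∧ 0 < n :=
    (hlim.eventually (gt_mem_nhds hδ₁)).and ((hlim.eventually (gt_mem_nhds hδ₂)).and
      ((hlim.eventually (gt_mem_nhds (by linarith))).and (eventually_gt_atTop 0)))
  obtain ⟨N, hN⟩ := eventually_atTop.1 hev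
  refine ⟨N, fun n hn => ?_⟩
  obtain ⟨hn1, hn2, hn3, hn4⟩ := hN n hn.le
  have hn0 : (0 : ℝ) < n := by exact_mod_cast hn4
  have hp : 0 < 1 / (n : ℝ) := by positivity
  have e2 : 2 / (n : ℝ) = 2 * (1 / n) := by ring
  have hsm : ∀ c, Differentiable ℝ (smoothStep n c) := fun c =>
    (contDiff_smoothStep n c).differentiable (by simp)
  have hsc : ∀ c, Continuous (deriv (smoothStep n c)) := fun c =>
    (contDiff_smoothStep n c).continuous_deriv (by simp)
  have hsi : ∀ c, IntegrableOn (deriv (smoothStep n c)) (Ioo a b) := fun c =>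
    ((hsc c).continuousOn.integrableOn_Icc).mono_set Ioo_subset_Icc_self
  have hint : ∀ c, ∫ x in Ioo a b, deriv (smoothStep n c) x = smoothStep n c b - smoothStep n c a := by
    intro c
    rw [← integral_Ioc_eq_integral_Ioo, ← intervalIntegral.integral_of_le hab.le]
    exact intervalIntegral.integral_deriv_eq_sub (fun x _ => hsm c x)
      ((hsc c).intervalIntegrable _ _)
  have hder : ∀ x, deriv (cutoff a b n) x =
      deriv (smoothStep n (a + 1 / n)) x - deriv (smoothStep n (b - 2 / n)) x := fun x =>
    deriv_sub (hsm _ x) (hsm _ x)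
  have hci : IntegrableOn (deriv (cutoff a b n)) (Ioo a b) := by
    have : deriv (cutoff a b n) = fun x => _ := funext hder
    rw [this]
    exact (hsi _).sub (hsi _)
  -- The two masses cancel, so the constant `G a` may be subtracted from `G` under the integral.
  have hzero : ∫ x in Ioo a b, deriv (cutoff a b n) x • G a = 0 := by
    rw [integral_smul_const]
    have : ∫ x in Ioo a b, deriv (cutoff a b n) x = 0 := by
      simp_rw [hder]
      rw [integral_sub (hsi _) (hsi _), hint, hint, smoothStep_of_ge hn0 (by linarith),
        smoothStep_of_le hn0.le (by linarith), smoothStep_of_ge hn0 (by linarith),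
        smoothStep_of_le hn0.le (by linarith)]
      ring
    rw [this, zero_smul]
  have hcG : IntegrableOn (fun x => deriv (cutoff a b n) x • G x) (Icc a b) := by
    refine ContinuousOn.integrableOn_Icc (ContinuousOn.smul ?_ hG)
    exact ((contDiff_cutoff a b n).continuous_deriv (by simp)).continuousOn
  have heq : ∫ x in Ioo a b, deriv (cutoff a b n) x • G x =
      ∫ x in Ioo a b, deriv (cutoff a b n) x • (G x - G a) := by
    simp_rw [smul_sub]
    rw [integral_sub (hcG.mono_set Ioo_subset_Icc_self) (hci.smul_const _), hzero, sub_zero]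
  rw [dist_zero_right, heq]
  have hnn : ∀ c x, 0 ≤ deriv (smoothStep n c) x := fun c x =>
    (monotone_smoothStep hn0.le c).deriv_nonneg
  have hbd : ∀ x ∈ Ioo a b, ‖deriv (cutoff a b n) x • (G x - G a)‖ ≤
      (deriv (smoothStep n (a + 1 / n)) x + deriv (smoothStep n (b - 2 / n)) x) * (ε / 3) := by
    intro x hx
    have hxI := Ioo_subset_Icc_self hx
    rw [norm_smul, hder, sub_eq_add_neg]
    -- The ramps near `a` and near `b` are disjoint for these `n`, so at most one derivative
    -- survives. On the right ramp periodicity turns `G a` into `G b`.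
    by_cases hxa : x ≤ a + 1 / n + 1 / n
    · rw [deriv_smoothStep_eq_zero (c := b - 2 / n) hn0 (Or.inl (by linarith)), neg_zero, add_zero,
        Real.norm_of_nonneg (hnn _ _)]
      refine mul_le_mul_of_nonneg_left ?_ (hnn _ _)
      rw [← dist_eq_norm]
      refine (h₁ x hxI ?_).le
      rw [Real.dist_eq, abs_of_pos (by linarith [hx.1])]
      linarith
    · rw [deriv_smoothStep_eq_zero (c := a + 1 / n) hn0 (Or.inr (by linarith)), zero_add, norm_neg,
        Real.norm_of_nonneg (hnn _ _), zero_add]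
      by_cases hxb : x < b - 2 / n
      · rw [deriv_smoothStep_eq_zero hn0 (Or.inl hxb)]
        simp
      refine mul_le_mul_of_nonneg_left ?_ (hnn _ _)
      rw [← dist_eq_norm, hper]
      refine (h₂ x hxI ?_).le
      rw [Real.dist_eq, abs_of_neg (by linarith [hx.2])]
      linarith
  calc ‖∫ x in Ioo a b, deriv (cutoff a b n) x • (G x - G a)‖
      ≤ ∫ x in Ioo a b, (deriv (smoothStep n (a + 1 / n)) x +
          deriv (smoothStep n (b - 2 / n)) x) * (ε / 3) := by
        refine norm_integral_le_of_norm_le (((hsi _).add (hsi _)).mul_const _) ?_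
        filter_upwards [ae_restrict_mem measurableSet_Ioo] with x hx using hbd x hx
    _ = 2 * (ε / 3) := by
        rw [integral_mul_const, integral_add (hsi _) (hsi _), hint, hint,
          smoothStep_of_ge hn0 (by linarith),
          smoothStep_of_le hn0.le (by linarith), smoothStep_of_ge hn0 (by linarith),
          smoothStep_of_le hn0.le (by linarith)]
        ring
    _ < ε := by linarith

/-- The product of `φ` with the cutoff is an admissible test function. As `n → ∞` the term
containing the derivative of the cutoff vanishes, because `φ • u` takes equal values at the end
points. -/
theorem IsWeakDeriv.integral_deriv_smul_eq_of_periodic [CompleteSpace E] {a b : ℝ} (hab : a < b)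
    {u v : ℝ → E} (h : IsWeakDeriv a b u v) (hu : ContinuousOn u (Icc a b)) (hper : u a = u b)
    (hv : IntegrableOn v (Ioo a b)) {φ : ℝ → ℝ} (hφ : ContDiff ℝ ∞ φ) (hφper : φ a = φ b) :
    ∫ x in Ioo a b, deriv φ x • u x = -∫ x in Ioo a b, φ x • v x := by
  have hφc := hφ.continuous
  have hφ' : Continuous (deriv φ) := hφ.continuous_deriv (by simp)
  have hφu : IntegrableOn (fun x => deriv φ x • u x) (Ioo a b) :=
    ((hφ'.continuousOn.smul hu).integrableOn_Icc).mono_set Ioo_subset_Icc_self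
  have hφv : IntegrableOn (fun x => φ x • v x) (Ioo a b) := by
    obtain ⟨C, hC⟩ := isCompact_Icc.exists_bound_of_continuousOn (s := Icc a b) hφc.continuousOn
    refine Integrable.bdd_smul hv C hφc.aestronglyMeasurable ?_
    filter_upwards [ae_restrict_mem measurableSet_Ioo] with x hx
      using hC x (Ioo_subset_Icc_self hx)
  have lim1 := tendsto_integral_cutoff_smul hφu
  have lim2 := (tendsto_integral_cutoff_smul hφv).neg
  have lim3 := tendsto_integral_deriv_cutoff_smul hab (G := fun x => φ x • u x)
    (hφc.continuousOn.smul hu) (by rw [hφper, hper])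
  have lim4 := lim1.add lim3
  rw [add_zero] at lim4
  refine tendsto_nhds_unique (lim4.congr' ?_) lim2
  have hlim : Tendsto (fun n : ℕ => 4 * (1 / (n : ℝ))) atTop (𝓝 0) := by
    simpa using tendsto_one_div_atTop_nhds_zero_nat.const_mul (4 : ℝ)
  filter_upwards [hlim.eventually (gt_mem_nhds (sub_pos.2 hab)), eventually_gt_atTop 0] with n h1 h2
  have hn : (0 : ℝ) < n := by exact_mod_cast h2
  have hp : 0 < 1 / (n : ℝ) := by positivity
  have e4 : 4 / (n : ℝ) = 4 * (1 / n) := by ring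
  have hχ := contDiff_cutoff a b n
  have hsupp := tsupport_cutoff_subset (a := a) (b := b) hn (by linarith)
  have hsub : tsupport (fun x => φ x * cutoff a b n x) ⊆ tsupport (cutoff a b n) :=
    tsupport_mul_subset_right
  have key := h.integral_eq (fun x => φ x * cutoff a b n x) (hφ.mul hχ)
    (HasCompactSupport.of_support_subset_isCompact isCompact_Icc
      ((subset_tsupport _).trans (hsub.trans hsupp)))
    (hsub.trans (hsupp.trans (Icc_subset_Ioo (by linarith) (by linarith))))
  have hc1 : IntegrableOn (fun x => cutoff a b n x • deriv φ x • u x) (Ioo a b) :=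
    ((hχ.continuous.continuousOn.smul (hφ'.continuousOn.smul hu)).integrableOn_Icc).mono_set
      Ioo_subset_Icc_self
  have hc2 : IntegrableOn (fun x => deriv (cutoff a b n) x • φ x • u x) (Ioo a b) :=
    (((hχ.continuous_deriv (by simp)).continuousOn.smul
      (hφc.continuousOn.smul hu)).integrableOn_Icc).mono_set Ioo_subset_Icc_self
  rw [← integral_add hc1 hc2]
  convert key using 1
  · refine integral_congr_ae (Eventually.of_forall fun x => ?_)
    have hd : deriv (fun x => φ x * cutoff a b n x) x =
        deriv φ x * cutoff a b n x + φ x * deriv (cutoff a b n) x :=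
      deriv_mul (hφ.differentiable (by simp) x) (hχ.differentiable (by simp) x)
    simp only [hd, add_smul, smul_smul]
    ring_nf
  · congr 1
    refine integral_congr_ae (Eventually.of_forall fun x => ?_)
    simp only [smul_smul]
    ring_nf

end

theorem freq_mul_sub {a b : ℝ} (hab : a < b) (l : ℤ) : freq a b l * (b - a) = l * (2 * Real.pi) := by
  have : b - a ≠ 0 := (sub_pos.2 hab).ne'
  unfold freq
  field_simp

/-- The Fourier coefficients of the weak derivative of a periodic function. -/
theorem IsWeakDeriv.fourierCoef_eq {a b : ℝ} (hab : a < b) {u v : ℝ → Spinor}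
    (h : IsWeakDeriv a b u v) (hu : ContinuousOn u (Icc a b)) (hper : u a = u b)
    (hv : IntegrableOn v (Ioo a b)) (l : ℤ) :
    fourierCoef a b v l = (Complex.I * freq a b l) • fourierCoef a b u l := by
  set μ := freq a b l with hμ
  have hμb : μ * (b - a) = l * (2 * Real.pi) := freq_mul_sub hab l
  -- Weak derivatives are tested against real functions only, so the exponential is split into its
  -- cosine and sine parts.
  have hexp : ∀ x : ℝ, Complex.exp (-(Complex.I * (μ * (x - a) : ℝ))) =
      (Real.cos (μ * (x - a)) : ℂ) - (Real.sin (μ * (x - a)) : ℂ) * Complex.I := by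
    intro x
    rw [show -(Complex.I * ((μ * (x - a) : ℝ) : ℂ)) = (-(μ * (x - a)) : ℝ) * Complex.I by
      push_cast; ring, Complex.exp_mul_I, ← Complex.ofReal_cos, ← Complex.ofReal_sin,
      Real.cos_neg, Real.sin_neg]
    push_cast
    ring
  have hcs : ContDiff ℝ ∞ fun x : ℝ => Real.cos (μ * (x - a)) :=
    Real.contDiff_cos.comp (by fun_prop)
  have hsn : ContDiff ℝ ∞ fun x : ℝ => Real.sin (μ * (x - a)) :=
    Real.contDiff_sin.comp (by fun_prop)
  have hdc : ∀ x, deriv (fun x : ℝ => Real.cos (μ * (x - a))) x = -μ * Real.sin (μ * (x - a)) := by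
    intro x
    have : HasDerivAt (fun x : ℝ => μ * (x - a)) μ x := by
      simpa using ((hasDerivAt_id x).sub_const a).const_mul μ
    rw [(this.cos).deriv]
    ring
  have hds : ∀ x, deriv (fun x : ℝ => Real.sin (μ * (x - a))) x = μ * Real.cos (μ * (x - a)) := by
    intro x
    have : HasDerivAt (fun x : ℝ => μ * (x - a)) μ x := by
      simpa using ((hasDerivAt_id x).sub_const a).const_mul μ
    rw [(this.sin).deriv]
    ring
  have k1 := h.integral_deriv_smul_eq_of_periodic hab hu hper hv hcs (by
    simp [hμb, Real.cos_int_mul_two_pi])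
  have k2 := h.integral_deriv_smul_eq_of_periodic hab hu hper hv hsn (by
    have : Real.sin ((l : ℝ) * (2 * Real.pi)) = 0 := by
      rw [show (l : ℝ) * (2 * Real.pi) = ((2 * l : ℤ) : ℝ) * Real.pi by push_cast; ring]
      exact Real.sin_int_mul_pi _
    simp [hμb, this])
  simp_rw [hdc, mul_smul] at k1
  simp_rw [hds, mul_smul] at k2
  rw [integral_smul] at k1 k2
  have hbint : ∀ {w : ℝ → Spinor}, IntegrableOn w (Ioo a b) → ∀ {φ : ℝ → ℝ}, Continuous φ →
      (∀ x, |φ x| ≤ 1) → IntegrableOn (fun x => φ x • w x) (Ioo a b) := fun hw φ hφ hφ1 =>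
    Integrable.bdd_smul hw 1 hφ.aestronglyMeasurable (Eventually.of_forall hφ1)
  have hui : IntegrableOn u (Ioo a b) := hu.integrableOn_Icc.mono_set Ioo_subset_Icc_self
  have hsplit : ∀ {w : ℝ → Spinor}, IntegrableOn w (Ioo a b) →
      ∫ x in Ioo a b, Complex.exp (-(Complex.I * (μ * (x - a) : ℝ))) • w x =
        (∫ x in Ioo a b, Real.cos (μ * (x - a)) • w x) -
          Complex.I • ∫ x in Ioo a b, Real.sin (μ * (x - a)) • w x := by
    intro w hw
    rw [← integral_smul, ← integral_sub (hbint hw hcs.continuous fun x => Real.abs_cos_le_one _)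
      (g := fun x => Complex.I • Real.sin (μ * (x - a)) • w x)
      ((hbint hw hsn.continuous fun x => Real.abs_sin_le_one _).smul Complex.I)]
    refine integral_congr_ae (Eventually.of_forall fun x => ?_)
    simp only [hexp, sub_smul, mul_comm _ Complex.I, mul_smul, Complex.coe_smul]
  unfold fourierCoef
  rw [← hμ, hsplit hv, hsplit hui, ← neg_eq_iff_eq_neg.2 k1, ← neg_eq_iff_eq_neg.2 k2,
    smul_comm (Complex.I * (μ : ℂ))]
  congr 1
  simp only [smul_sub, smul_smul, ← Complex.coe_smul, ← neg_smul, Complex.ofReal_neg]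
  rw [show Complex.I * (μ : ℂ) * Complex.I = (Complex.I * Complex.I) * μ by ring, Complex.I_mul_I]
  module

/-! ### Fourier series in `(L²(a, b))²` -/

section Fourier

variable (a b : ℝ)

theorem memLp_expWave (l : ℤ) (p : ℝ≥0∞) : MemLp
    (fun x : ℝ => Complex.exp (-(Complex.I * (freq a b l * (x - a) : ℝ)))) p
    (intervalMeasure a b) := by
  refine MemLp.of_bound (C := 1) ?_ (Eventually.of_forall fun x => ?_)
  · exact (by fun_prop : Continuous _).aestronglyMeasurable
  · rw [show -(Complex.I * ((freq a b l * (x - a) : ℝ) : ℂ)) =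
      (-(freq a b l * (x - a)) : ℝ) * Complex.I by push_cast; ring, Complex.norm_exp_ofReal_mul_I]

/-- The Fourier coefficient as a bounded linear operator. -/
noncomputable def coef (l : ℤ) : L2 a b →L[ℂ] Spinor :=
  ((1 / (b - a) : ℝ) : ℂ) • (ContinuousLinearMap.lsmul ℂ ℂ : ℂ →L[ℂ] Spinor →L[ℂ] Spinor).lpPairing
    (intervalMeasure a b) 2 2 (memLp_expWave a b l 2).toLp

theorem coef_apply (l : ℤ) (u : L2 a b) : coef a b l u = fourierCoef a b u l := by
  rw [coef, smul_apply, ContinuousLinearMap.lpPairing_eq_integral, fourierCoef]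
  congr 1
  refine integral_congr_ae ?_
  filter_upwards [(memLp_expWave a b l 2).coeFn_toLp] with x hx
  rw [hx, ContinuousLinearMap.lsmul_apply]

variable {a b} in
theorem fourierCoef_congr {u v : ℝ → Spinor} (h : u =ᵐ[intervalMeasure a b] v) (l : ℤ) :
    fourierCoef a b u l = fourierCoef a b v l := by
  unfold fourierCoef
  congr 1
  refine integral_congr_ae ?_
  filter_upwards [h] with x hx
  rw [hx]

theorem coef_toLp (l : ℤ) {u : ℝ → Spinor} (hu : MemLp u 2 (intervalMeasure a b)) :
    coef a b l hu.toLp = fourierCoef a b u l := by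
  rw [coef_apply, fourierCoef_congr hu.coeFn_toLp]

/-- The plane wave `c ↦ e^{iμ_l(x - a)} c` as a linear map into `(L²(a, b))²`. -/
noncomputable def waveL (l : ℤ) : Spinor →L[ℂ] L2 a b :=
  LinearMap.toContinuousLinearMap
    { toFun := fun c => (memLp_planeWave a b l c).toLp
      map_add' := fun c d => by
        rw [← MemLp.toLp_add]
        congr 1
        ext1 x
        simp [planeWave]
      map_smul' := fun r c => by
        rw [RingHom.id_apply, ← MemLp.toLp_const_smul]
        congr 1
        ext1 x
        simp only [planeWave, Pi.smul_apply]
        rw [smul_comm] }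

theorem waveL_apply (l : ℤ) (c : Spinor) : waveL a b l c = (memLp_planeWave a b l c).toLp := rfl

variable {a b}

theorem integral_exp_freq (hab : a < b) (l : ℤ) :
    ∫ x in Ioo a b, Complex.exp (Complex.I * (freq a b l * (x - a) : ℝ)) =
      if l = 0 then ((b - a : ℝ) : ℂ) else 0 := by
  split_ifs with h
  · subst h
    simp [freq, hab.le]
  have hμ : freq a b l ≠ 0 := by
    have : b - a ≠ 0 := (sub_pos.2 hab).ne'
    unfold freq
    have := Real.pi_ne_zero
    have : (l : ℝ) ≠ 0 := by exact_mod_cast h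
    positivity
  have hc : Complex.I * (freq a b l : ℂ) ≠ 0 := by
    simp [hμ]
  rw [← integral_Ioc_eq_integral_Ioo, ← intervalIntegral.integral_of_le hab.le]
  have key : ∀ x : ℝ, HasDerivAt (fun x : ℝ => (Complex.I * (freq a b l : ℂ))⁻¹ *
      Complex.exp (Complex.I * (freq a b l * (x - a) : ℝ)))
      (Complex.exp (Complex.I * (freq a b l * (x - a) : ℝ))) x := by
    intro x
    have h1 : HasDerivAt (fun x : ℝ => Complex.I * ((freq a b l * (x - a) : ℝ) : ℂ))
        (Complex.I * (freq a b l : ℂ)) x := by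
      have : HasDerivAt (fun x : ℝ => freq a b l * (x - a)) (freq a b l) x := by
        simpa using ((hasDerivAt_id x).sub_const a).const_mul (freq a b l)
      exact (this.ofReal_comp).const_mul _
    refine ((h1.cexp).const_mul (Complex.I * (freq a b l : ℂ))⁻¹).congr_deriv ?_
    rw [mul_comm (Complex.exp _), inv_mul_cancel_left₀ hc]
  rw [intervalIntegral.integral_eq_sub_of_hasDerivAt (fun x _ => key x)
    ((by fun_prop : Continuous _).intervalIntegrable _ _), freq_mul_sub hab]
  have : Complex.exp (Complex.I * ((l * (2 * Real.pi) : ℝ) : ℂ)) = 1 := by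
    rw [Complex.exp_eq_one_iff]
    exact ⟨l, by push_cast; ring⟩
  rw [this]
  simp

theorem freq_sub (l k : ℤ) : freq a b (l - k) = freq a b l - freq a b k := by
  unfold freq
  push_cast
  ring

theorem exp_freq_sub_smul (k l : ℤ) (c : Spinor) (x : ℝ) :
    Complex.exp (-(Complex.I * (freq a b l * (x - a) : ℝ))) • planeWave a b k c x =
      Complex.exp (Complex.I * (freq a b (k - l) * (x - a) : ℝ)) • c := by
  rw [planeWave, smul_smul, ← Complex.exp_add, freq_sub]
  congr 2
  push_cast
  ring

theorem coef_waveL (hab : a < b) (l k : ℤ) (c : Spinor) :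
    coef a b l (waveL a b k c) = if l = k then c else 0 := by
  rw [waveL_apply, coef_toLp, fourierCoef]
  simp_rw [exp_freq_sub_smul]
  rw [integral_smul_const, integral_exp_freq hab, smul_smul]
  have hb : b - a ≠ 0 := (sub_pos.2 hab).ne'
  by_cases h : l = k
  · rw [if_pos h, if_pos (by omega), ← Complex.ofReal_mul, one_div_mul_cancel hb,
      Complex.ofReal_one, one_smul]
  · rw [if_neg h, if_neg (by omega), mul_zero, zero_smul]

/-- The waves here are centred at `a`, those of `fourierCoeffOn` at `0`. The two coefficients differ
by a phase, and Parseval's identity sees only moduli. -/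
theorem norm_fourierCoef_component (hab : a < b) {u : ℝ → Spinor}
    (hu : MemLp u 2 (intervalMeasure a b)) (l : ℤ) (j : Fin 2) :
    ‖fourierCoef a b u l j‖ = ‖fourierCoeffOn hab (fun x => u x j) l‖ := by
  have hint : Integrable (fun x : ℝ => Complex.exp (-(Complex.I * (freq a b l * (x - a) : ℝ))) •
      u x) (intervalMeasure a b) :=
    (hu.integrable (by norm_num)).smul_of_top_right (memLp_expWave a b l ∞)
  have hproj := (EuclideanSpace.proj (𝕜 := ℂ) j).integral_comp_comm hint
  have hphase : ∀ x : ℝ, Complex.exp (-(Complex.I * (freq a b l * (x - a) : ℝ))) =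
      Complex.exp ((freq a b l * a : ℝ) * Complex.I) *
        fourier (-l) (x : AddCircle (b - a)) := by
    intro x
    rw [fourier_coe_apply, ← Complex.exp_add, freq]
    congr 1
    push_cast
    ring
  have heq : fourierCoef a b u l j = Complex.exp ((freq a b l * a : ℝ) * Complex.I) *
      fourierCoeffOn hab (fun x => u x j) l := by
    rw [fourierCoeffOn_eq_integral, intervalIntegral.integral_of_le hab.le,
      integral_Ioc_eq_integral_Ioo, fourierCoef, PiLp.smul_apply]
    simp only [PiLp.proj_apply] at hproj
    rw [← hproj, Complex.real_smul, smul_eq_mul, mul_left_comm,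
      ← integral_const_mul (Complex.exp ((freq a b l * a : ℝ) * Complex.I))]
    refine congrArg _ (integral_congr_ae (Eventually.of_forall fun x => ?_))
    simp only [PiLp.smul_apply, smul_eq_mul, hphase, mul_assoc]
  rw [heq, norm_mul, Complex.norm_exp_ofReal_mul_I, one_mul]

theorem norm_sq_eq_integral (u : L2 a b) : ‖u‖ ^ 2 = ∫ x in Ioo a b, ‖u x‖ ^ 2 := by
  have h := congr_arg RCLike.re (MeasureTheory.L2.inner_def (𝕜 := ℂ) u u)
  rw [← integral_re (MeasureTheory.L2.integrable_inner (𝕜 := ℂ) u u)] at h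
  simpa only [← norm_sq_eq_re_inner] using h

/-- **Parseval's identity**. -/
theorem hasSum_norm_coef_sq (hab : a < b) (u : L2 a b) :
    HasSum (fun l => ‖coef a b l u‖ ^ 2) ((b - a)⁻¹ * ‖u‖ ^ 2) := by
  have hu := Lp.memLp u
  have hc : ∀ j : Fin 2, MemLp (fun x => u x j) 2 (intervalMeasure a b) := fun j =>
    (EuclideanSpace.proj (𝕜 := ℂ) j).comp_memLp' hu
  have h := fun j => hasSum_sq_fourierCoeffOn hab (f := fun x => u x j)
    (by rw [← Measure.restrict_congr_set Ioo_ae_eq_Ioc]; exact hc j)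
  convert (h 0).add (h 1) using 1
  · ext l
    rw [coef_apply, EuclideanSpace.norm_sq_eq, Fin.sum_univ_two, norm_fourierCoef_component hab hu,
      norm_fourierCoef_component hab hu]
  · rw [norm_sq_eq_integral, smul_eq_mul, smul_eq_mul, ← mul_add,
      intervalIntegral.integral_of_le hab.le, intervalIntegral.integral_of_le hab.le,
      integral_Ioc_eq_integral_Ioo, integral_Ioc_eq_integral_Ioo,
      ← integral_add ((hc 0).integrable_norm_pow (by norm_num))
        ((hc 1).integrable_norm_pow (by norm_num))]
    congr 1
    refine integral_congr_ae (Eventually.of_forall fun x => ?_)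
    simp only [EuclideanSpace.norm_sq_eq, Fin.sum_univ_two]

theorem norm_sq_eq_tsum (hab : a < b) (u : L2 a b) :
    ‖u‖ ^ 2 = (b - a) * ∑' l, ‖coef a b l u‖ ^ 2 := by
  rw [(hasSum_norm_coef_sq hab u).tsum_eq, mul_inv_cancel_left₀ (sub_pos.2 hab).ne']

/-- By Parseval's identity. This reduces operator identities on `L2 a b` to identities between 2 × 2
matrices. -/
theorem ext_coef (hab : a < b) {u v : L2 a b} (h : ∀ l, coef a b l u = coef a b l v) : u = v := by
  have : ‖u - v‖ ^ 2 = 0 := by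
    rw [norm_sq_eq_tsum hab]
    simp [h]
  simpa [sub_eq_zero] using this

theorem norm_sum_waveL_sq (hab : a < b) (s : Finset ℤ) (c : ℤ → Spinor) :
    ‖∑ l ∈ s, waveL a b l (c l)‖ ^ 2 = (b - a) * ∑ l ∈ s, ‖c l‖ ^ 2 := by
  have hc : ∀ k, coef a b k (∑ l ∈ s, waveL a b l (c l)) = if k ∈ s then c k else 0 := by
    intro k
    rw [map_sum]
    simp_rw [coef_waveL hab]
    simp
  rw [norm_sq_eq_tsum hab]
  congr 1
  rw [tsum_eq_sum (s := s) (fun k hk => by rw [hc, if_neg hk]; simp)]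
  exact Finset.sum_congr rfl fun k hk => by rw [hc, if_pos hk]

/-- Orthogonality turns the norm of a finite block into a block of the scalar series, so Cauchy's
criterion carries over. -/
theorem summable_waveL (hab : a < b) {c : ℤ → Spinor} (hc : Summable fun l => ‖c l‖ ^ 2) :
    Summable fun l => waveL a b l (c l) := by
  have hba := sub_pos.2 hab
  rw [summable_iff_vanishing_norm] at hc ⊢
  intro ε hε
  obtain ⟨s, hs⟩ := hc (ε ^ 2 / (b - a)) (by positivity)
  refine ⟨s, fun t ht => ?_⟩
  have h := lt_of_abs_lt (hs t ht)
  rw [lt_div_iff₀' hba, ← norm_sum_waveL_sq hab] at h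
  exact lt_of_pow_lt_pow_left₀ 2 hε.le h

theorem coef_tsum_waveL (hab : a < b) {c : ℤ → Spinor} (hc : Summable fun l => ‖c l‖ ^ 2) (k : ℤ) :
    coef a b k (∑' l, waveL a b l (c l)) = c k := by
  rw [(coef a b k).map_tsum (summable_waveL hab hc)]
  simp_rw [coef_waveL hab]
  exact tsum_ite_eq k c |>.symm ▸ (by simp)

theorem hasSum_waveL_coef (hab : a < b) (u : L2 a b) :
    HasSum (fun l => waveL a b l (coef a b l u)) u := by
  have hs := (hasSum_norm_coef_sq hab u).summable
  convert (summable_waveL hab hs).hasSum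
  exact ext_coef hab fun l => (coef_tsum_waveL hab hs l).symm

/-- Parseval's identity lifts a bound on Fourier multipliers to `L²`; the factor `2` comes from (x +
y)² ≤ 2(x² + y²). -/
theorem norm_le_of_norm_coef_le_add (hab : a < b) {u v w : L2 a b} {C : ℝ}
    (h : ∀ l, ‖coef a b l u‖ ≤ C * (‖coef a b l v‖ + ‖coef a b l w‖)) :
    ‖u‖ ^ 2 ≤ 2 * C ^ 2 * (‖v‖ ^ 2 + ‖w‖ ^ 2) := by
  have hba := sub_pos.2 hab
  have hv := (hasSum_norm_coef_sq hab v).summable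
  have hw := (hasSum_norm_coef_sq hab w).summable
  rw [norm_sq_eq_tsum hab, norm_sq_eq_tsum hab, norm_sq_eq_tsum hab, ← mul_add, mul_left_comm,
    ← hv.tsum_add hw, ← tsum_mul_left (a := 2 * C ^ 2)]
  refine mul_le_mul_of_nonneg_left ?_ hba.le
  refine Summable.tsum_le_tsum (fun l => ?_) (hasSum_norm_coef_sq hab u).summable
    ((hv.add hw).mul_left _)
  calc ‖coef a b l u‖ ^ 2 ≤ (C * (‖coef a b l v‖ + ‖coef a b l w‖)) ^ 2 := by
        gcongr
        exact h l
    _ ≤ _ := by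
        rw [mul_pow, mul_comm 2, mul_assoc]
        gcongr
        nlinarith [sq_nonneg (‖coef a b l v‖ - ‖coef a b l w‖)]

end Fourier

/-! ### Exponentials of skew-adjoint operators -/

section Skew

variable {E : Type*} [NormedAddCommGroup E] [InnerProductSpace ℂ E] [CompleteSpace E]
  {X : E →L[ℂ] E}

theorem exp_mem_unitary (hX : X ∈ skewAdjoint (E →L[ℂ] E)) :
    NormedSpace.exp X ∈ unitary (E →L[ℂ] E) := by
  let +nondep : NormedAlgebra ℚ (E →L[ℂ] E) := .restrictScalars ℚ ℂ (E →L[ℂ] E)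
  exact NormedSpace.exp_mem_unitary_of_mem_skewAdjoint hX

theorem smul_mem_skewAdjoint (hX : X ∈ skewAdjoint (E →L[ℂ] E)) (t : ℝ) :
    t • X ∈ skewAdjoint (E →L[ℂ] E) := by
  rw [skewAdjoint.mem_iff, star_smul, skewAdjoint.mem_iff.1 hX, star_trivial, smul_neg]

theorem norm_exp_smul_apply (hX : X ∈ skewAdjoint (E →L[ℂ] E)) (t : ℝ) (w : E) :
    ‖NormedSpace.exp (t • X) w‖ = ‖w‖ :=
  ContinuousLinearMap.norm_map_of_mem_unitary (exp_mem_unitary (smul_mem_skewAdjoint hX t)) w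

theorem exp_add_smul_apply (s t : ℝ) (w : E) :
    NormedSpace.exp ((s + t) • X) w = NormedSpace.exp (s • X) (NormedSpace.exp (t • X) w) := by
  let +nondep : NormedAlgebra ℚ (E →L[ℂ] E) := .restrictScalars ℚ ℂ _
  rw [add_smul, NormedSpace.exp_add_of_commute ((Commute.refl X).smul_left s |>.smul_right t)]
  rfl

theorem exp_zero_smul_apply (w : E) : NormedSpace.exp ((0 : ℝ) • X) w = w := by
  rw [zero_smul, NormedSpace.exp_zero, one_apply_eq_self]

theorem hasDerivAt_exp_smul_apply (t : ℝ) (w : E) :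
    HasDerivAt (fun t : ℝ => NormedSpace.exp (t • X) w) (NormedSpace.exp (t • X) (X w)) t :=
  ((((ContinuousLinearMap.apply ℂ E w).restrictScalars ℝ).hasFDerivAt
    (x := NormedSpace.exp (t • X))).comp_hasDerivAt t (hasDerivAt_exp_smul_const (𝕂 := ℝ) X t) :)

/-- The derivative of the orbit has constant norm `‖X w‖` by unitarity. The bound thus involves `X
w` and not `‖X‖`, which for the free symbol is unbounded in the frequency. -/
theorem norm_exp_smul_apply_sub_le (hX : X ∈ skewAdjoint (E →L[ℂ] E)) (t : ℝ) (w : E) :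
    ‖NormedSpace.exp (t • X) w - w‖ ≤ |t| * ‖X w‖ := by
  have := Convex.norm_image_sub_le_of_norm_hasDerivWithin_le (s := univ) (x := 0) (y := t)
    (C := ‖X w‖) (fun x _ => (hasDerivAt_exp_smul_apply (X := X) x w).hasDerivWithinAt)
    (fun x _ => (norm_exp_smul_apply hX x _).le) convex_univ (mem_univ _) (mem_univ _)
  simpa [mul_comm] using this

omit [CompleteSpace E] in
theorem norm_sub_zero_le_of_norm_deriv_le {f f' : ℝ → E} (hf : ∀ t, HasDerivAt f (f' t) t)
    {T C : ℝ} (hT : 0 ≤ T) (hC : ∀ t ∈ Icc 0 T, ‖f' t‖ ≤ C) : ‖f T - f 0‖ ≤ C * T := by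
  have := Convex.norm_image_sub_le_of_norm_hasDerivWithin_le (s := Icc 0 T) (x := 0) (y := T)
    (fun x _ => (hf x).hasDerivWithinAt) hC (convex_Icc _ _) (left_mem_Icc.2 hT) (right_mem_Icc.2 hT)
  simpa [abs_of_nonneg hT] using this

/-- The derivative of the remainder is the first order remainder at `X w`. Bounding it by its
maximum over the interval gives up the factor 1/2. -/
theorem norm_exp_smul_apply_sub_sub_le (hX : X ∈ skewAdjoint (E →L[ℂ] E)) {t : ℝ} (ht : 0 ≤ t)
    (w : E) : ‖NormedSpace.exp (t • X) w - w - t • X w‖ ≤ t ^ 2 * ‖X (X w)‖ := by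
  have hd : ∀ s : ℝ, HasDerivAt (fun s : ℝ => NormedSpace.exp (s • X) w - w - s • X w)
      (NormedSpace.exp (s • X) (X w) - X w) s := fun s => by
    simpa using! ((hasDerivAt_exp_smul_apply (X := X) s w).sub_const w).sub
      ((hasDerivAt_id s).smul_const (X w))
  have h := norm_sub_zero_le_of_norm_deriv_le hd ht (C := t * ‖X (X w)‖) fun s hs => by
    refine (norm_exp_smul_apply_sub_le hX s (X w)).trans ?_
    rw [abs_of_nonneg hs.1]
    exact mul_le_mul_of_nonneg_right hs.2 (norm_nonneg _)
  simp at h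
  linarith

/-- Taylor expansion of order two of a one-parameter unitary group. -/
theorem norm_exp_smul_apply_taylor_le (hX : X ∈ skewAdjoint (E →L[ℂ] E)) {t : ℝ} (ht : 0 ≤ t)
    (w : E) : ‖NormedSpace.exp (t • X) w - w - t • X w - (t ^ 2 / 2) • X (X w)‖ ≤
      t ^ 3 * ‖X (X (X w))‖ := by
  have hd : ∀ s : ℝ, HasDerivAt
      (fun s : ℝ => NormedSpace.exp (s • X) w - w - s • X w - (s ^ 2 / 2) • X (X w))
      (NormedSpace.exp (s • X) (X w) - X w - s • X (X w)) s := fun s => by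
    have h2 : HasDerivAt (fun s : ℝ => s ^ 2 / 2) s s := by
      refine (((hasDerivAt_id s).pow 2).div_const 2).congr_deriv ?_
      simp
    simpa using! (((hasDerivAt_exp_smul_apply (X := X) s w).sub_const w).sub
      ((hasDerivAt_id s).smul_const (X w))).sub (h2.smul_const (X (X w)))
  have h := norm_sub_zero_le_of_norm_deriv_le hd ht (C := t ^ 2 * ‖X (X (X w))‖) fun s hs => by
    refine (norm_exp_smul_apply_sub_sub_le hX hs.1 (X w)).trans ?_
    have := hs.1
    have := hs.2
    gcongr
  simp at h
  linarith

end Skew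

/-! ### Matrices acting on spinors -/

/-- A `2 × 2` matrix as a bounded operator on `ℂ²`. -/
noncomputable abbrev actL (B : Matrix (Fin 2) (Fin 2) ℂ) : Spinor →L[ℂ] Spinor :=
  Matrix.toEuclideanCLM (n := Fin 2) (𝕜 := ℂ) B

theorem act_eq_actL (B : Matrix (Fin 2) (Fin 2) ℂ) (w : Spinor) : act B w = actL B w := rfl

theorem actL_exp (B : Matrix (Fin 2) (Fin 2) ℂ) :
    actL (NormedSpace.exp B) = NormedSpace.exp (actL B) := by
  open scoped Matrix.Norms.Operator in
  exact NormedSpace.map_exp (Matrix.toEuclideanCLM (n := Fin 2) (𝕜 := ℂ))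
    (LinearMap.continuous_of_finiteDimensional
      (Matrix.toEuclideanCLM (n := Fin 2) (𝕜 := ℂ)).toAlgEquiv.toLinearMap) B

theorem actL_mem_skewAdjoint {B : Matrix (Fin 2) (Fin 2) ℂ} (hB : Bᴴ = -B) :
    actL B ∈ skewAdjoint (Spinor →L[ℂ] Spinor) := by
  rw [skewAdjoint.mem_iff, ← map_star, Matrix.star_eq_conjTranspose, hB, map_neg]

theorem norm_actL_σ₁ (w : Spinor) : ‖actL σ₁ w‖ = ‖w‖ := by
  have h0 : (actL σ₁ w) 0 = w 1 := by
    simp [actL, Matrix.ofLp_toEuclideanCLM, σ₁, Matrix.mulVec, dotProduct]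
  have h1 : (actL σ₁ w) 1 = w 0 := by
    simp [actL, Matrix.ofLp_toEuclideanCLM, σ₁, Matrix.mulVec, dotProduct]
  rw [EuclideanSpace.norm_eq, EuclideanSpace.norm_eq, Fin.sum_univ_two, Fin.sum_univ_two, h0, h1,
    add_comm]

theorem norm_actL_σ₃ (w : Spinor) : ‖actL σ₃ w‖ = ‖w‖ := by
  have h0 : (actL σ₃ w) 0 = w 0 := by
    simp [actL, Matrix.ofLp_toEuclideanCLM, σ₃, Matrix.mulVec, dotProduct]
  have h1 : (actL σ₃ w) 1 = -w 1 := by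
    simp [actL, Matrix.ofLp_toEuclideanCLM, σ₃, Matrix.mulVec, dotProduct]
  rw [EuclideanSpace.norm_eq, EuclideanSpace.norm_eq, Fin.sum_univ_two, Fin.sum_univ_two, h0, h1,
    norm_neg]

theorem conjTranspose_σ₁ : σ₁ᴴ = σ₁ := by
  ext i j
  fin_cases i <;> fin_cases j <;> simp [σ₁]

theorem conjTranspose_σ₃ : σ₃ᴴ = σ₃ := by
  ext i j
  fin_cases i <;> fin_cases j <;> simp [σ₃]

/-! ### The free group -/

/-- The Fourier symbol `-iΓ_l` of `𝐓`. -/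
noncomputable def freeGen (a b : ℝ) (l : ℤ) : Spinor →L[ℂ] Spinor :=
  actL (-Complex.I • freeSymbol a b l)

theorem freeGen_mem_skewAdjoint (a b : ℝ) (l : ℤ) :
    freeGen a b l ∈ skewAdjoint (Spinor →L[ℂ] Spinor) := by
  refine actL_mem_skewAdjoint ?_
  rw [Matrix.conjTranspose_smul, freeSymbol, Matrix.conjTranspose_add, Matrix.conjTranspose_smul,
    conjTranspose_σ₁, conjTranspose_σ₃]
  simp [add_comm]

theorem freeGen_apply (a b : ℝ) (l : ℤ) (w : Spinor) : freeGen a b l w =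
    -(Complex.I • ((freq a b l : ℂ) • actL σ₁ w + actL σ₃ w)) := by
  rw [freeGen, freeSymbol, actL, map_smul, map_add, map_smul]
  exact neg_smul Complex.I _

theorem norm_freeGen_apply_le (a b : ℝ) (l : ℤ) (w : Spinor) :
    ‖freeGen a b l w‖ ≤ ‖w‖ + ‖(Complex.I * freq a b l) • w‖ := by
  rw [freeGen_apply, norm_neg, norm_smul, Complex.norm_I, one_mul]
  refine (norm_add_le _ _).trans ?_
  rw [norm_smul, norm_actL_σ₁, norm_actL_σ₃, add_comm, norm_smul, norm_mul, Complex.norm_I, one_mul]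

theorem exp_freeSymbol (a b t : ℝ) (l : ℤ) (w : Spinor) :
    act (NormedSpace.exp (-(Complex.I * (t : ℂ)) • freeSymbol a b l)) w =
      NormedSpace.exp (t • freeGen a b l) w := by
  have h : actL (-(Complex.I * (t : ℂ)) • freeSymbol a b l) = t • freeGen a b l := by
    ext1 w
    rw [freeGen, actL, actL, map_smul, map_smul]
    change (-(Complex.I * (t : ℂ))) • actL (freeSymbol a b l) w =
      t • (-Complex.I • actL (freeSymbol a b l) w)
    rw [← Complex.coe_smul, smul_smul]
    congr 1
    ring
  rw [act_eq_actL, actL_exp, h]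

section FreeGroup

variable {a b : ℝ} (hab : a < b)

theorem summable_norm_exp_coef_sq (hab : a < b) (t : ℝ) (u : L2 a b) :
    Summable fun l => ‖NormedSpace.exp (t • freeGen a b l) (coef a b l u)‖ ^ 2 := by
  simp_rw [norm_exp_smul_apply (freeGen_mem_skewAdjoint a b _)]
  exact (hasSum_norm_coef_sq hab u).summable

/-- The group `e^{t𝐓}` on `(L²(a, b))²`. -/
noncomputable def freeGroup (t : ℝ) : L2 a b →ₗᵢ[ℂ] L2 a b where
  toFun u := ∑' l, waveL a b l (NormedSpace.exp (t • freeGen a b l) (coef a b l u))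
  map_add' u v := ext_coef hab fun l => by
    rw [map_add, coef_tsum_waveL hab (summable_norm_exp_coef_sq hab t _),
      coef_tsum_waveL hab (summable_norm_exp_coef_sq hab t _),
      coef_tsum_waveL hab (summable_norm_exp_coef_sq hab t _), map_add, map_add]
  map_smul' c u := ext_coef hab fun l => by
    rw [RingHom.id_apply, map_smul, coef_tsum_waveL hab (summable_norm_exp_coef_sq hab t _),
      coef_tsum_waveL hab (summable_norm_exp_coef_sq hab t _), map_smul, map_smul]
  norm_map' u := by
    change ‖∑' l, waveL a b l (NormedSpace.exp (t • freeGen a b l) (coef a b l u))‖ = _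
    rw [← sq_eq_sq₀ (norm_nonneg _) (norm_nonneg _), norm_sq_eq_tsum hab, norm_sq_eq_tsum hab]
    simp_rw [coef_tsum_waveL hab (summable_norm_exp_coef_sq hab t _),
      norm_exp_smul_apply (freeGen_mem_skewAdjoint a b _)]

theorem coef_freeGroup (t : ℝ) (u : L2 a b) (l : ℤ) :
    coef a b l (freeGroup hab t u) = NormedSpace.exp (t • freeGen a b l) (coef a b l u) :=
  coef_tsum_waveL hab (summable_norm_exp_coef_sq hab t u) l

theorem freeFlow_eq_freeGroup (t : ℝ) {f : ℝ → Spinor} {u : L2 a b}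
    (hf : f =ᵐ[intervalMeasure a b] u) : freeFlow a b t f = freeGroup hab t u := by
  have h : ∀ l, act (NormedSpace.exp (-(Complex.I * (t : ℂ)) • freeSymbol a b l))
      (fourierCoef a b f l) = NormedSpace.exp (t • freeGen a b l) (coef a b l u) := fun l => by
    rw [exp_freeSymbol, coef_apply, fourierCoef_congr hf]
  unfold freeFlow
  simp_rw [h]
  rfl

theorem freeGroup_add (s t : ℝ) (u : L2 a b) :
    freeGroup hab (s + t) u = freeGroup hab s (freeGroup hab t u) :=
  ext_coef hab fun l => by
    rw [coef_freeGroup, coef_freeGroup, coef_freeGroup, exp_add_smul_apply]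

theorem freeGroup_zero (u : L2 a b) : freeGroup hab 0 u = u :=
  ext_coef hab fun l => by
    rw [coef_freeGroup, exp_zero_smul_apply]

theorem freeGroup_apply_neg (t : ℝ) (u : L2 a b) : freeGroup hab t (freeGroup hab (-t) u) = u := by
  rw [← freeGroup_add, add_neg_cancel, freeGroup_zero]

theorem freeGroup_waveL (t : ℝ) (l : ℤ) (c : Spinor) :
    freeGroup hab t (waveL a b l c) = waveL a b l (NormedSpace.exp (t • freeGen a b l) c) :=
  ext_coef hab fun k => by
    rw [coef_freeGroup, coef_waveL hab, coef_waveL hab]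
    split_ifs with h
    · rw [h]
    · rw [map_zero]

/-- The group `e^{t𝐓}` is strongly continuous. -/
theorem continuous_freeGroup_apply (u : L2 a b) : Continuous fun t => freeGroup hab t u := by
  have h := hasSum_waveL_coef hab u
  -- Isometry makes the convergence of the truncated Fourier sums uniform in `t`, and each
  -- truncation evolves continuously.
  refine TendstoUniformly.continuous (p := atTop)
    (F := fun (s : Finset ℤ) t => freeGroup hab t (∑ l ∈ s, waveL a b l (coef a b l u))) ?_
    (Frequently.of_forall fun s => ?_)
  · rw [Metric.tendstoUniformly_iff]
    intro ε hε
    filter_upwards [(Metric.tendsto_nhds.1 h) ε hε] with s hs t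
    rwa [(freeGroup hab t).dist_map, dist_comm]
  · simp_rw [map_sum, freeGroup_waveL]
    refine continuous_finsetSum _ fun l _ => (waveL a b l).continuous.comp ?_
    exact continuous_iff_continuousAt.2 fun t => (hasDerivAt_exp_smul_apply t _).continuousAt

/-- Strong continuity handles the time argument, isometry the vector argument. -/
theorem continuousOn_freeGroup_apply {X : Type*} [TopologicalSpace X] {f : X → ℝ} {g : X → L2 a b}
    {s : Set X} (hf : ContinuousOn f s) (hg : ContinuousOn g s) :
    ContinuousOn (fun x => freeGroup hab (f x) (g x)) s := by
  intro x hx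
  have h1 : Tendsto (fun y => freeGroup hab (f y) (g x)) (𝓝[s] x) (𝓝 (freeGroup hab (f x) (g x))) :=
    ((continuous_freeGroup_apply hab (g x)).tendsto (f x)).comp (hf x hx)
  have h2 : Tendsto (fun y => freeGroup hab (f y) (g y) - freeGroup hab (f y) (g x)) (𝓝[s] x)
      (𝓝 0) := by
    rw [tendsto_zero_iff_norm_tendsto_zero]
    simp_rw [← map_sub, LinearIsometry.norm_map]
    exact (tendsto_iff_norm_sub_tendsto_zero.1 (hg x hx))
  have h3 := h2.add h1
  simp only [sub_add_cancel, zero_add] at h3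
  exact h3

end FreeGroup

/-! ### Sobolev regularity through Fourier coefficients -/

section Sobolev

variable {a b : ℝ}

/-- `v` is the derivative of `u` in the sense of Fourier series. -/
def IsFourierDeriv (u v : L2 a b) : Prop :=
  ∀ l, coef a b l v = (Complex.I * freq a b l) • coef a b l u

theorem IsFourierDeriv.add {u v u' v' : L2 a b} (h : IsFourierDeriv u v)
    (h' : IsFourierDeriv u' v') : IsFourierDeriv (u + u') (v + v') := fun l => by
  rw [map_add, map_add, h l, h' l, smul_add]

theorem IsFourierDeriv.sub {u v u' v' : L2 a b} (h : IsFourierDeriv u v)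
    (h' : IsFourierDeriv u' v') : IsFourierDeriv (u - u') (v - v') := fun l => by
  rw [map_sub, map_sub, h l, h' l, smul_sub]

/-- Both e^{t𝐓} and ∂ₓ act frequency by frequency, the latter by a scalar, so they commute. -/
theorem IsFourierDeriv.freeGroup {u v : L2 a b} (h : IsFourierDeriv u v) (hab : a < b) (t : ℝ) :
    IsFourierDeriv (freeGroup hab t u) (freeGroup hab t v) := fun l => by
  rw [coef_freeGroup, coef_freeGroup, h l, map_smul]

/-- `u` has `k` derivatives in `L²`, with `u` and these derivatives bounded by `K`. -/
def SobolevBound : ℕ → ℝ → L2 a b → Prop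
  | 0, K, u => ‖u‖ ≤ K
  | k + 1, K, u => ‖u‖ ≤ K ∧ ∃ v, IsFourierDeriv u v ∧ SobolevBound k K v

theorem SobolevBound.norm_le : ∀ {k : ℕ} {K : ℝ} {u : L2 a b}, SobolevBound k K u → ‖u‖ ≤ K
  | 0, _, _, h => h
  | _ + 1, _, _, h => h.1

theorem SobolevBound.nonneg {k : ℕ} {K : ℝ} {u : L2 a b} (h : SobolevBound k K u) : 0 ≤ K :=
  (norm_nonneg u).trans h.norm_le

theorem SobolevBound.of_succ : ∀ {k : ℕ} {K : ℝ} {u : L2 a b}, SobolevBound (k + 1) K u →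
    SobolevBound k K u
  | 0, _, _, h => h.1
  | _ + 1, _, _, ⟨h, v, hv, hb⟩ => ⟨h, v, hv, hb.of_succ⟩

theorem SobolevBound.mono : ∀ {k : ℕ} {K K' : ℝ} {u : L2 a b}, SobolevBound k K u → K ≤ K' →
    SobolevBound k K' u
  | 0, _, _, _, h, hK => le_trans (α := ℝ) h hK
  | _ + 1, _, _, _, ⟨h, v, hv, hb⟩, hK => ⟨h.trans hK, v, hv, hb.mono hK⟩

theorem SobolevBound.add : ∀ {k : ℕ} {K K' : ℝ} {u u' : L2 a b}, SobolevBound k K u →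
    SobolevBound k K' u' → SobolevBound k (K + K') (u + u')
  | 0, _, _, _, _, h, h' => (norm_add_le _ _).trans (add_le_add (α := ℝ) h h')
  | _ + 1, _, _, _, _, ⟨h, v, hv, hb⟩, ⟨h', v', hv', hb'⟩ =>
    ⟨(norm_add_le _ _).trans (add_le_add h h'), v + v', hv.add hv', hb.add hb'⟩

theorem SobolevBound.map {A : L2 a b → L2 a b} {C : ℝ} (hC : 0 ≤ C) (hA : ∀ u, ‖A u‖ ≤ C * ‖u‖)
    (hd : ∀ u v, IsFourierDeriv u v → IsFourierDeriv (A u) (A v)) :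
    ∀ {k : ℕ} {K : ℝ} {u : L2 a b}, SobolevBound k K u → SobolevBound k (C * K) (A u)
  | 0, _, u, h => (hA u).trans (mul_le_mul_of_nonneg_left h hC)
  | _ + 1, _, u, ⟨h, v, hv, hb⟩ =>
    ⟨(hA u).trans (mul_le_mul_of_nonneg_left h hC), A v, hd u v hv, hb.map hC hA hd⟩

theorem SobolevBound.freeGroup {k : ℕ} {K : ℝ} {u : L2 a b} (h : SobolevBound k K u) (hab : a < b)
    (t : ℝ) : SobolevBound k K (freeGroup hab t u) := by
  have := SobolevBound.map (A := DiracSplitting.freeGroup hab t) zero_le_one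
    (fun u => by rw [LinearIsometry.norm_map, one_mul]) (fun u v h => h.freeGroup hab t) h
  rwa [one_mul] at this

/-- The symbol of 𝐓 is at most 1 + |μ_l| in norm, so one space derivative pays for one power of `t`.
-/
theorem norm_freeGroup_sub_le {K : ℝ} {u : L2 a b} (h : SobolevBound 1 K u) (hab : a < b) (t : ℝ) :
    ‖freeGroup hab t u - u‖ ≤ 2 * |t| * K := by
  obtain ⟨hu, v, huv, hv⟩ := h
  have hv : ‖v‖ ≤ K := hv
  have hK := (norm_nonneg u).trans hu
  have key := norm_le_of_norm_coef_le_add hab (u := freeGroup hab t u - u) (v := u) (w := v)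
    (C := |t|) fun l => by
      rw [map_sub, coef_freeGroup, huv l]
      refine (norm_exp_smul_apply_sub_le (freeGen_mem_skewAdjoint a b l) t _).trans ?_
      gcongr
      exact norm_freeGen_apply_le a b l _
  refine le_of_sq_le_sq (key.trans ?_) (by positivity)
  calc 2 * |t| ^ 2 * (‖u‖ ^ 2 + ‖v‖ ^ 2) ≤ 2 * |t| ^ 2 * (K ^ 2 + K ^ 2) := by gcongr
    _ = (2 * |t| * K) ^ 2 := by ring

/-- The previous estimate applied to every derivative, so that time differences can be iterated. -/
theorem SobolevBound.freeGroup_sub (hab : a < b) (t : ℝ) : ∀ {k : ℕ} {K : ℝ} {u : L2 a b},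
    SobolevBound (k + 1) K u →
    SobolevBound k (2 * |t| * K) (DiracSplitting.freeGroup hab t u - u)
  | 0, _, _, h => norm_freeGroup_sub_le h hab t
  | _ + 1, _, _, ⟨h, v, hv, hb⟩ =>
    ⟨norm_freeGroup_sub_le ⟨h, v, hv, hb.norm_le⟩ hab t, _, (hv.freeGroup hab t).sub hv,
      hb.freeGroup_sub hab t⟩

/-- The second difference factors as (e^{t𝐓} - 1)² e^{-t𝐓}, and each first difference contributes a
factor 2|t|. -/
theorem norm_freeGroup_second_difference_le {K : ℝ} {u : L2 a b} (h : SobolevBound 2 K u)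
    (hab : a < b) (t : ℝ) :
    ‖freeGroup hab t u + freeGroup hab (-t) u - (2 : ℝ) • u‖ ≤ 4 * t ^ 2 * K := by
  have h1 := norm_freeGroup_sub_le ((h.freeGroup hab (-t)).freeGroup_sub hab t) hab t
  rw [freeGroup_apply_neg, map_sub, freeGroup_apply_neg] at h1
  rw [two_smul]
  convert h1 using 1
  · congr 1
    abel
  · rw [← sq_abs]
    ring

/-- A bound for the weighted sum of squares of the Fourier coefficients bounds two derivatives. -/
theorem sobolevBound_two_of_sum_le (hab : a < b) {u : L2 a b} {K : ℝ} (hK : 0 ≤ K)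
    (h : ∀ s : Finset ℤ, ∑ l ∈ s, (1 + freq a b l ^ 2) ^ 2 * ‖coef a b l u‖ ^ 2 ≤ K ^ 2) :
    SobolevBound 2 (√(b - a) * K) u := by
  have hba := sub_pos.2 hab
  -- One multiplier argument produces `u` and its two derivatives: `z` is taken to be 1, iμ_l and
  -- (iμ_l)².
  have main : ∀ z : ℤ → ℂ, (∀ l, ‖z l‖ ≤ 1 + freq a b l ^ 2) →
      ∃ v : L2 a b, (∀ l, coef a b l v = z l • coef a b l u) ∧ ‖v‖ ≤ √(b - a) * K := by
    intro z hz
    have hle : ∀ l, ‖z l • coef a b l u‖ ^ 2 ≤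
        (1 + freq a b l ^ 2) ^ 2 * ‖coef a b l u‖ ^ 2 := fun l => by
      rw [norm_smul, mul_pow]
      have := hz l
      gcongr
    have hfin : ∀ s : Finset ℤ, ∑ l ∈ s, ‖z l • coef a b l u‖ ^ 2 ≤ K ^ 2 := fun s =>
      (Finset.sum_le_sum fun l _ => hle l).trans (h s)
    have hsum : Summable fun l => ‖z l • coef a b l u‖ ^ 2 :=
      summable_of_sum_le (fun l => by positivity) hfin
    refine ⟨∑' l, waveL a b l (z l • coef a b l u), coef_tsum_waveL hab hsum, ?_⟩
    refine le_of_sq_le_sq ?_ (by positivity)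
    rw [norm_sq_eq_tsum hab, mul_pow, Real.sq_sqrt hba.le]
    simp_rw [coef_tsum_waveL hab hsum]
    exact mul_le_mul_of_nonneg_left (hsum.tsum_le_of_sum_le hfin) hba.le
  have habs : ∀ x : ℝ, |x| ≤ 1 + x ^ 2 := fun x => by
    nlinarith [sq_abs x, sq_nonneg (|x| - 1), abs_nonneg x]
  obtain ⟨u₀, h0, h0'⟩ := main (fun _ => 1) fun l => by simp; positivity
  obtain ⟨v, h1, h1'⟩ := main (fun l => Complex.I * freq a b l) fun l => by
    simpa using habs (freq a b l)
  obtain ⟨w, h2, h2'⟩ := main (fun l => (Complex.I * freq a b l) * (Complex.I * freq a b l))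
    fun l => by simp [← sq]
  have hu : u₀ = u := ext_coef hab fun l => by rw [h0, one_smul]
  subst hu
  exact ⟨h0', v, h1, h1', w, fun l => by rw [h2, h1, smul_smul], h2'⟩

end Sobolev

/-! ### Multiplication operators -/

section Multiplication

variable {a b : ℝ}

/-- Multiplication by an essentially bounded function. -/
noncomputable def mulOp (f : Lp ℂ ∞ (intervalMeasure a b)) : L2 a b →L[ℂ] L2 a b :=
  (ContinuousLinearMap.lsmul ℂ ℂ : ℂ →L[ℂ] Spinor →L[ℂ] Spinor).holderL
    (intervalMeasure a b) ∞ 2 2 f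

theorem coeFn_mulOp (f : Lp ℂ ∞ (intervalMeasure a b)) (u : L2 a b) :
    mulOp f u =ᵐ[intervalMeasure a b] fun x => f x • u x :=
  (ContinuousLinearMap.lsmul ℂ ℂ : ℂ →L[ℂ] Spinor →L[ℂ] Spinor).coeFn_holder f u

/-- Pointwise application of a constant matrix. -/
noncomputable def matOp (a b : ℝ) (B : Matrix (Fin 2) (Fin 2) ℂ) : L2 a b →L[ℂ] L2 a b :=
  (actL B).compLpL 2 (intervalMeasure a b)

theorem coeFn_matOp (B : Matrix (Fin 2) (Fin 2) ℂ) (u : L2 a b) :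
    matOp a b B u =ᵐ[intervalMeasure a b] fun x => actL B (u x) :=
  (actL B).coeFn_compLpL u

theorem integrable_exp_smul (l : ℤ) {u : ℝ → Spinor} (hu : MemLp u 2 (intervalMeasure a b)) :
    Integrable (fun x : ℝ => Complex.exp (-(Complex.I * (freq a b l * (x - a) : ℝ))) • u x)
      (intervalMeasure a b) :=
  (hu.integrable (by norm_num)).smul_of_top_right (memLp_expWave a b l ∞)

theorem fourierCoef_actL (B : Matrix (Fin 2) (Fin 2) ℂ) {u : ℝ → Spinor}
    (hu : MemLp u 2 (intervalMeasure a b)) (l : ℤ) :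
    fourierCoef a b (fun x => actL B (u x)) l = actL B (fourierCoef a b u l) := by
  unfold fourierCoef
  rw [map_smul, ← (actL B).integral_comp_comm (integrable_exp_smul l hu)]
  simp_rw [map_smul]

theorem coef_matOp (B : Matrix (Fin 2) (Fin 2) ℂ) (u : L2 a b) (l : ℤ) :
    coef a b l (matOp a b B u) = actL B (coef a b l u) := by
  rw [coef_apply, fourierCoef_congr (coeFn_matOp B u), fourierCoef_actL B (Lp.memLp u), coef_apply]

theorem IsFourierDeriv.matOp {u v : L2 a b} (h : IsFourierDeriv u v)
    (B : Matrix (Fin 2) (Fin 2) ℂ) : IsFourierDeriv (matOp a b B u) (matOp a b B v) := fun l => by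
  rw [coef_matOp, coef_matOp, h l, map_smul]

theorem IsFourierDeriv.const_smul {u v : L2 a b} (h : IsFourierDeriv u v) (c : ℂ) :
    IsFourierDeriv (c • u) (c • v) := fun l => by
  rw [map_smul, map_smul, h l, smul_comm]

/-- The operators `F` and `G` satisfy the Leibniz rule `(F u)' = G u + F u'`. -/
def IsLeibnizPair (F G : L2 a b →L[ℂ] L2 a b) : Prop :=
  ∀ u v, IsFourierDeriv u v → IsFourierDeriv (F u) (G u + F v)

theorem SobolevBound.leibniz_one {F G : L2 a b →L[ℂ] L2 a b} (h : IsLeibnizPair F G) {K α β : ℝ}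
    (hF : ∀ u, ‖F u‖ ≤ α * ‖u‖) (hG : ∀ u, ‖G u‖ ≤ β * ‖u‖) (hα : 0 ≤ α) (hβ : 0 ≤ β)
    {u : L2 a b} (hu : SobolevBound 1 K u) : SobolevBound 1 ((α + β) * K) (F u) := by
  have hK := hu.nonneg
  obtain ⟨h0, v, hv, h1⟩ := hu
  have h1 : ‖v‖ ≤ K := h1
  refine ⟨(hF u).trans (mul_le_mul (by linarith) h0 (norm_nonneg _) (by positivity)), _,
    h u v hv, ?_⟩
  refine (norm_add_le _ _).trans ?_
  rw [add_comm α, add_mul]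
  exact add_le_add ((hG u).trans (mul_le_mul_of_nonneg_left h0 hβ))
    ((hF v).trans (mul_le_mul_of_nonneg_left h1 hα))

/-- With `G` and `H` as successive derivatives of `F`, the expansion (Fu)'' = Hu + 2Gu' + Fu''
explains the constant `α + 2 * β + γ`. -/
theorem SobolevBound.leibniz_two {F G H : L2 a b →L[ℂ] L2 a b} (hFG : IsLeibnizPair F G)
    (hGH : IsLeibnizPair G H) {K α β γ : ℝ} (hF : ∀ u, ‖F u‖ ≤ α * ‖u‖)
    (hG : ∀ u, ‖G u‖ ≤ β * ‖u‖) (hH : ∀ u, ‖H u‖ ≤ γ * ‖u‖) (hα : 0 ≤ α) (hβ : 0 ≤ β) (hγ : 0 ≤ γ)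
    {u : L2 a b} (hu : SobolevBound 2 K u) :
    SobolevBound 2 ((α + 2 * β + γ) * K) (F u) := by
  have hK := hu.nonneg
  have hu1 := hu.of_succ
  obtain ⟨h0, v, hv, h1⟩ := hu
  refine ⟨(hF u).trans (mul_le_mul (by linarith) h0 (norm_nonneg _) (by positivity)), _,
    hFG u v hv, ?_⟩
  refine ((hu1.leibniz_one hGH hG hH hβ hγ).add (h1.leibniz_one hFG hF hG hα hβ)).mono (le_of_eq ?_)
  ring

/-- A plane wave only shifts frequencies, so a matrix entry of a multiplication operator is a
Fourier coefficient of the multiplier. -/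
theorem coef_mulOp_waveL {f : Lp ℂ ∞ (intervalMeasure a b)} {D : ℝ → ℝ}
    (hf : f =ᵐ[intervalMeasure a b] fun x => (D x : ℂ)) (l k : ℤ) (c : Spinor) :
    coef a b l (mulOp f (waveL a b k c)) = fourierCoef a b (fun x => D x • c) (l - k) := by
  rw [coef_apply, fourierCoef, fourierCoef]
  congr 1
  refine integral_congr_ae ?_
  filter_upwards [coeFn_mulOp f (waveL a b k c), hf, (memLp_planeWave a b k c).coeFn_toLp]
    with x h1 h2 h3
  rw [h1, waveL_apply, h3, h2, smul_comm, exp_freq_sub_smul, Complex.coe_smul, smul_comm, freq_sub,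
    freq_sub]
  congr 3
  push_cast
  ring

theorem IsWeakDeriv.smul_const {u v : ℝ → ℝ} (h : IsWeakDeriv a b u v) (c : Spinor) :
    IsWeakDeriv a b (fun x => u x • c) (fun x => v x • c) where
  locallyIntegrable := fun x hx => by
    obtain ⟨s, hs, hi⟩ := h.locallyIntegrable x hx
    exact ⟨s, hs, hi.smul_const c⟩
  locallyIntegrable_deriv := fun x hx => by
    obtain ⟨s, hs, hi⟩ := h.locallyIntegrable_deriv x hx
    exact ⟨s, hs, hi.smul_const c⟩
  integral_eq φ h1 h2 h3 := by
    have := h.integral_eq φ h1 h2 h3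
    simp_rw [← smul_assoc]
    rw [integral_smul_const, integral_smul_const, this, neg_smul]

/-- Each Fourier coefficient is a continuous functional, so plane waves suffice. On these the
Leibniz rule is the identity μ_{l-k} + μ_k = μ_l, once the derivative of the multiplier has its
expected coefficients; this is where periodicity of the potential enters. -/
theorem isLeibnizPair_mulOp (hab : a < b) {f g : Lp ℂ ∞ (intervalMeasure a b)}
    {D D' : ℝ → ℝ} (hf : f =ᵐ[intervalMeasure a b] fun x => (D x : ℂ))
    (hg : g =ᵐ[intervalMeasure a b] fun x => (D' x : ℂ)) (h : IsWeakDeriv a b D D')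
    (hD : ContinuousOn D (Icc a b)) (hper : D a = D b) (hD' : IntegrableOn D' (Ioo a b)) :
    IsLeibnizPair (mulOp f) (mulOp g) := by
  intro u v huv l
  have hwave : ∀ k c, coef a b l (mulOp g (waveL a b k c)) +
      coef a b l (mulOp f (waveL a b k ((Complex.I * freq a b k) • c))) =
        (Complex.I * freq a b l) • coef a b l (mulOp f (waveL a b k c)) := by
    intro k c
    have key := (h.smul_const c).fourierCoef_eq hab (hD.smul continuousOn_const) (by rw [hper])
      (hD'.smul_const c) (l - k)
    rw [map_smul, map_smul, map_smul, coef_mulOp_waveL hg, coef_mulOp_waveL hf, key, freq_sub,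
      ← add_smul]
    congr 1
    push_cast
    ring
  have hu := hasSum_waveL_coef hab u
  have hv := hasSum_waveL_coef hab v
  have s1 := ((coef a b l).comp (mulOp g)).hasSum hu
  have s2 := ((coef a b l).comp (mulOp f)).hasSum hv
  have s3 := (((coef a b l).comp (mulOp f)).hasSum hu).const_smul (Complex.I * freq a b l)
  have s4 := s1.add s2
  simp only [ContinuousLinearMap.comp_apply, huv _] at s3 s4
  simp only [hwave] at s4
  rw [map_add]
  exact s4.unique s3

/-- Only the potential and its first two derivatives are used, hence `2 ≤ m`. One constant serves
all orders up to two. -/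
theorem exists_mulOp (hab : a < b) {m : ℕ} (hm : 2 ≤ m) {V : ℝ → ℝ}
    (hV : MemPeriodicSobolev a b m ∞ V) :
    ∃ (F : L2 a b →L[ℂ] L2 a b) (β : ℝ), 0 ≤ β ∧
      (∀ u, F u =ᵐ[intervalMeasure a b] fun x => (V x : ℂ) • u x) ∧
      ∀ k ≤ 2, ∀ K u, SobolevBound k K u → SobolevBound k (β * K) (F u) := by
  obtain ⟨D, hD⟩ := hV
  have hmem : ∀ i ≤ 2, MemLp (fun x => (D i x : ℂ)) ∞ (intervalMeasure a b) := fun i hi =>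
    Complex.ofRealCLM.comp_memLp' (hD.memLp i (hi.trans hm))
  have hint : ∀ i ≤ 2, IntegrableOn (D i) (Ioo a b) := fun i hi =>
    (hD.memLp i (hi.trans hm)).integrable (by simp)
  obtain ⟨F, G, H, hF, hFG, hGH⟩ : ∃ F G H : L2 a b →L[ℂ] L2 a b,
      (∀ u, F u =ᵐ[intervalMeasure a b] fun x => (V x : ℂ) • u x) ∧
      IsLeibnizPair F G ∧ IsLeibnizPair G H := by
    refine ⟨mulOp (hmem 0 (by norm_num)).toLp, mulOp (hmem 1 (by norm_num)).toLp,
      mulOp (hmem 2 (by norm_num)).toLp, fun u => ?_, ?_, ?_⟩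
    · filter_upwards [coeFn_mulOp (hmem 0 (by norm_num)).toLp u, (hmem 0 (by norm_num)).coeFn_toLp,
        hD.zero] with x h1 h2 h3
      rw [h1, h2, h3]
    · exact isLeibnizPair_mulOp hab (hmem 0 (by norm_num)).coeFn_toLp
        (hmem 1 (by norm_num)).coeFn_toLp (hD.weakDeriv 0 (by omega)) (hD.continuousOn 0 (by omega))
        (hD.periodic 0 (by omega)) (hint 1 (by norm_num))
    · exact isLeibnizPair_mulOp hab (hmem 1 (by norm_num)).coeFn_toLp
        (hmem 2 (by norm_num)).coeFn_toLp (hD.weakDeriv 1 (by omega)) (hD.continuousOn 1 (by omega))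
        (hD.periodic 1 (by omega)) (hint 2 (by norm_num))
  have hbd : ∀ F : L2 a b →L[ℂ] L2 a b, ∃ α : ℝ, 0 ≤ α ∧ ∀ u, ‖F u‖ ≤ α * ‖u‖ := fun F =>
    ⟨‖F‖, norm_nonneg _, F.le_opNorm⟩
  obtain ⟨α, hα, hFα⟩ := hbd F
  obtain ⟨β, hβ, hGβ⟩ := hbd G
  obtain ⟨γ, hγ, hHγ⟩ := hbd H
  refine ⟨F, α + 2 * β + γ, by positivity, hF, fun k hk K u hu => ?_⟩
  have hK := hu.nonneg
  interval_cases k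
  · exact (hFα u).trans (mul_le_mul (by linarith) hu.norm_le (norm_nonneg _) (by positivity))
  · exact (hu.leibniz_one hFG hFα hGβ hα hβ).mono (mul_le_mul_of_nonneg_right (by linarith) hK)
  · exact hu.leibniz_two hFG hGH hFα hGβ hHγ hα hβ hγ

theorem exists_potentialOp (hab : a < b) {m : ℕ} (hm : 2 ≤ m) {V A₁ : ℝ → ℝ}
    (hV : MemPeriodicSobolev a b m ∞ V) (hA₁ : MemPeriodicSobolev a b m ∞ A₁) :
    ∃ (P : L2 a b →L[ℂ] L2 a b) (β : ℝ), 0 ≤ β ∧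
      (∀ u, P u =ᵐ[intervalMeasure a b] fun x => act (potentialMatrix V A₁ x) (u x)) ∧
      ∀ k ≤ 2, ∀ K u, SobolevBound k K u → SobolevBound k (β * K) (P u) := by
  obtain ⟨F, β, hβ, hF, hFb⟩ := exists_mulOp hab hm hV
  obtain ⟨G, γ, hγ, hG, hGb⟩ := exists_mulOp hab hm hA₁
  obtain ⟨δ, hδ, hS⟩ : ∃ δ : ℝ, 0 ≤ δ ∧ ∀ u, ‖matOp a b σ₁ u‖ ≤ δ * ‖u‖ :=
    ⟨‖matOp a b σ₁‖, norm_nonneg _, (matOp a b σ₁).le_opNorm⟩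
  refine ⟨-Complex.I • F + Complex.I • (matOp a b σ₁).comp G, β + δ * γ,
    by positivity, fun u => ?_, fun k hk K u hu => ?_⟩
  · have e1 := Lp.coeFn_add (-Complex.I • F u) (Complex.I • matOp a b σ₁ (G u))
    filter_upwards [e1, Lp.coeFn_smul (-Complex.I) (F u),
      Lp.coeFn_smul Complex.I (matOp a b σ₁ (G u)), hF u, hG u, coeFn_matOp σ₁ (G u)]
      with x h1 h2 h3 h4 h5 h6
    change (-Complex.I • F u + Complex.I • matOp a b σ₁ (G u) : L2 a b) x = _
    rw [h1, Pi.add_apply, h2, h3, Pi.smul_apply, Pi.smul_apply, h4, h6, h5, act_eq_actL,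
      potentialMatrix, map_smul (actL σ₁)]
    have h7 : actL (-Complex.I • ((V x : ℂ) • (1 : Matrix (Fin 2) (Fin 2) ℂ) - (A₁ x : ℂ) • σ₁))
        (u x) = -Complex.I • ((V x : ℂ) • u x - (A₁ x : ℂ) • actL σ₁ (u x)) := by
      rw [actL, map_smul, map_sub, map_smul, map_smul, map_one]
      rfl
    rw [h7]
    rw [smul_sub, neg_smul, neg_smul, sub_neg_eq_add]
  · rw [add_mul]
    refine SobolevBound.add ?_ ?_
    · have := (hFb k hk K u hu).map (A := fun w => -Complex.I • w) zero_le_one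
        (fun w => by rw [norm_smul, norm_neg, Complex.norm_I]) fun _ _ h => h.const_smul _
      rwa [one_mul] at this
    · rw [mul_assoc]
      exact (hGb k hk K u hu).map (A := fun w => Complex.I • matOp a b σ₁ w) hδ
        (fun w => by
          rw [norm_smul, Complex.norm_I, one_mul]
          exact hS w) fun _ _ h => (h.matOp _).const_smul _

end Multiplication

/-! ### The potential flow -/

section PotentialFlow

variable {a b : ℝ} {V A₁ : ℝ → ℝ}

/-- The potentials are real and σ₁ is Hermitian. This makes e^{s𝐕} unitary at every point. -/
theorem actL_potentialMatrix_mem_skewAdjoint (V A₁ : ℝ → ℝ) (x : ℝ) :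
    actL (potentialMatrix V A₁ x) ∈ skewAdjoint (Spinor →L[ℂ] Spinor) := by
  refine actL_mem_skewAdjoint ?_
  rw [potentialMatrix, Matrix.conjTranspose_smul, Matrix.conjTranspose_sub,
    Matrix.conjTranspose_smul, Matrix.conjTranspose_smul, conjTranspose_σ₁,
    Matrix.conjTranspose_one]
  simp

theorem potentialFlow_apply (V A₁ : ℝ → ℝ) (s : ℝ) (u : ℝ → Spinor) (x : ℝ) :
    potentialFlow V A₁ s u x = NormedSpace.exp (s • actL (potentialMatrix V A₁ x)) (u x) := by
  have h : actL ((s : ℂ) • potentialMatrix V A₁ x) = s • actL (potentialMatrix V A₁ x) := by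
    ext1 w
    rw [actL, map_smul]
    rfl
  rw [potentialFlow, act_eq_actL, actL_exp, h]

theorem norm_potentialFlow_apply (V A₁ : ℝ → ℝ) (s : ℝ) (u : ℝ → Spinor) (x : ℝ) :
    ‖potentialFlow V A₁ s u x‖ = ‖u x‖ := by
  rw [potentialFlow_apply, norm_exp_smul_apply (actL_potentialMatrix_mem_skewAdjoint V A₁ x)]

theorem aestronglyMeasurable_potentialFlow (hV : AEStronglyMeasurable V (intervalMeasure a b))
    (hA₁ : AEStronglyMeasurable A₁ (intervalMeasure a b)) (s : ℝ) {u : ℝ → Spinor}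
    (hu : AEStronglyMeasurable u (intervalMeasure a b)) :
    AEStronglyMeasurable (potentialFlow V A₁ s u) (intervalMeasure a b) := by
  have hc : Continuous fun p : ℝ × ℝ =>
      (-Complex.I) • ((p.1 : ℂ) • (1 : Matrix (Fin 2) (Fin 2) ℂ) - (p.2 : ℂ) • σ₁) := by
    fun_prop
  have hL : Continuous (actL : Matrix (Fin 2) (Fin 2) ℂ → Spinor →L[ℂ] Spinor) := by
    open scoped Matrix.Norms.Operator in
    exact LinearMap.continuous_of_finiteDimensional
      (Matrix.toEuclideanCLM (n := Fin 2) (𝕜 := ℂ)).toAlgEquiv.toLinearMap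
  have hE : Continuous fun X : Spinor →L[ℂ] Spinor => NormedSpace.exp (s • X) := by
    let +nondep : NormedAlgebra ℚ (Spinor →L[ℂ] Spinor) :=
      .restrictScalars ℚ ℂ (Spinor →L[ℂ] Spinor)
    exact NormedSpace.exp_continuous.comp (continuous_const_smul s)
  have hm := (hE.comp (hL.comp hc)).comp_aestronglyMeasurable (hV.prodMk hA₁)
  have := (isBoundedBilinearMap_apply (𝕜 := ℂ) (E := Spinor) (F := Spinor)).continuous
    |>.comp_aestronglyMeasurable (hm.prodMk hu)
  refine this.congr (Eventually.of_forall fun x => ?_)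
  rw [potentialFlow_apply]
  rfl

theorem memLp_potentialFlow (hV : AEStronglyMeasurable V (intervalMeasure a b))
    (hA₁ : AEStronglyMeasurable A₁ (intervalMeasure a b)) (s : ℝ) {u : ℝ → Spinor}
    (hu : MemLp u 2 (intervalMeasure a b)) :
    MemLp (potentialFlow V A₁ s u) 2 (intervalMeasure a b) :=
  hu.of_le (aestronglyMeasurable_potentialFlow hV hA₁ s hu.aestronglyMeasurable)
    (Eventually.of_forall fun x => (norm_potentialFlow_apply V A₁ s u x).le)

/-- The operator `e^{s𝐕}` on `(L²(a, b))²`. -/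
noncomputable def potentialGroup (hV : AEStronglyMeasurable V (intervalMeasure a b))
    (hA₁ : AEStronglyMeasurable A₁ (intervalMeasure a b)) (s : ℝ) (u : L2 a b) : L2 a b :=
  (memLp_potentialFlow hV hA₁ s (Lp.memLp u)).toLp

variable (hV : AEStronglyMeasurable V (intervalMeasure a b))
  (hA₁ : AEStronglyMeasurable A₁ (intervalMeasure a b))

theorem coeFn_potentialGroup (s : ℝ) (u : L2 a b) :
    potentialGroup hV hA₁ s u =ᵐ[intervalMeasure a b]
      fun x => NormedSpace.exp (s • actL (potentialMatrix V A₁ x)) (u x) := by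
  filter_upwards [(memLp_potentialFlow hV hA₁ s (Lp.memLp u)).coeFn_toLp] with x hx
  rw [potentialGroup, hx, potentialFlow_apply]

theorem norm_potentialGroup_sub_le (s : ℝ) (u v : L2 a b) :
    ‖potentialGroup hV hA₁ s u - potentialGroup hV hA₁ s v‖ ≤ ‖u - v‖ := by
  refine Lp.norm_le_norm_of_ae_le ?_
  filter_upwards [Lp.coeFn_sub (potentialGroup hV hA₁ s u) (potentialGroup hV hA₁ s v),
    Lp.coeFn_sub u v, coeFn_potentialGroup hV hA₁ s u, coeFn_potentialGroup hV hA₁ s v]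
    with x h1 h2 h3 h4
  rw [h1, h2, Pi.sub_apply, Pi.sub_apply, h3, h4, ← map_sub,
    norm_exp_smul_apply (actL_potentialMatrix_mem_skewAdjoint V A₁ x)]

/-- The Taylor estimate for unitary groups holds at almost every point with remainder `P (P (P u))`,
and pointwise domination passes to the `L²` norm. -/
theorem norm_potentialGroup_taylor_le {P : L2 a b →L[ℂ] L2 a b}
    (hP : ∀ u, P u =ᵐ[intervalMeasure a b] fun x => act (potentialMatrix V A₁ x) (u x))
    {s : ℝ} (hs : 0 ≤ s) (u : L2 a b) :
    ‖potentialGroup hV hA₁ s u - u - s • P u - (s ^ 2 / 2) • P (P u)‖ ≤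
      s ^ 3 * ‖P (P (P u))‖ := by
  rw [← Real.norm_of_nonneg (pow_nonneg hs 3), ← norm_smul]
  refine Lp.norm_le_norm_of_ae_le ?_
  filter_upwards [
    Lp.coeFn_sub (potentialGroup hV hA₁ s u - u - s • P u) ((s ^ 2 / 2) • P (P u)),
    Lp.coeFn_sub (potentialGroup hV hA₁ s u - u) (s • P u),
    Lp.coeFn_sub (potentialGroup hV hA₁ s u) u, Lp.coeFn_smul s (P u),
    Lp.coeFn_smul (s ^ 2 / 2) (P (P u)), Lp.coeFn_smul (s ^ 3) (P (P (P u))),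
    coeFn_potentialGroup hV hA₁ s u, hP u, hP (P u), hP (P (P u))]
    with x h1 h2 h3 h4 h5 h6 h7 h8 h9 h10
  rw [h1, Pi.sub_apply, h2, Pi.sub_apply, h3, Pi.sub_apply, h4, h5, h6, h7, Pi.smul_apply,
    Pi.smul_apply, Pi.smul_apply, h10, h9, h8, norm_smul, Real.norm_of_nonneg (pow_nonneg hs 3)]
  exact norm_exp_smul_apply_taylor_le (actL_potentialMatrix_mem_skewAdjoint V A₁ x) hs (u x)

end PotentialFlow

/-! ### Second order expansion of evolution equations -/

section Expansion

variable {H : Type*} [NormedAddCommGroup H] [NormedSpace ℂ H] [CompleteSpace H]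

/-- Error of the midpoint rule, from a bound for symmetric second differences. -/
theorem norm_integral_sub_midpoint_le {g : ℝ → H} (hg : Continuous g) {τ C : ℝ} (hτ : 0 ≤ τ)
    (hC : 0 ≤ C) (h : ∀ s, ‖g (τ / 2 + s) + g (τ / 2 - s) - (2 : ℝ) • g (τ / 2)‖ ≤ C * s ^ 2) :
    ‖(∫ s in (0 : ℝ)..τ, g s) - τ • g (τ / 2)‖ ≤ C * τ ^ 3 := by
  -- Averaging with the reflection about the midpoint leaves only symmetric second differences, so
  -- `g` need not be differentiable.
  have hrefl : ∫ s in (0 : ℝ)..τ, g (τ - s) = ∫ s in (0 : ℝ)..τ, g s := by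
    rw [intervalIntegral.integral_comp_sub_left]
    simp
  have hint : ∫ s in (0 : ℝ)..τ, (g s + g (τ - s) - (2 : ℝ) • g (τ / 2)) =
      (2 : ℝ) • ((∫ s in (0 : ℝ)..τ, g s) - τ • g (τ / 2)) := by
    have hr : Continuous fun s => g (τ - s) := hg.comp (by fun_prop)
    have hadd : Continuous fun s => g s + g (τ - s) := hg.add hr
    rw [intervalIntegral.integral_sub (hadd.intervalIntegrable _ _)
      (continuous_const.intervalIntegrable _ _),
      intervalIntegral.integral_add (hg.intervalIntegrable _ _) (hr.intervalIntegrable _ _), hrefl,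
      intervalIntegral.integral_const, sub_zero, two_smul ℝ (_ - _), two_smul ℝ (g _), smul_add]
    abel
  have hbound : ‖∫ s in (0 : ℝ)..τ, (g s + g (τ - s) - (2 : ℝ) • g (τ / 2))‖ ≤
      C * τ ^ 2 * |τ - 0| := by
    refine intervalIntegral.norm_integral_le_of_norm_le_const fun s hs => ?_
    rw [uIoc_of_le hτ] at hs
    have := h (s - τ / 2)
    rw [show τ / 2 + (s - τ / 2) = s by ring, show τ / 2 - (s - τ / 2) = τ - s by ring] at this
    refine this.trans (mul_le_mul_of_nonneg_left ?_ hC)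
    refine sq_le_sq' ?_ ?_ <;> linarith [hs.1, hs.2]
  rw [hint, norm_smul, Real.norm_ofNat, sub_zero, abs_of_nonneg hτ] at hbound
  have hp : 0 ≤ C * τ ^ 3 := by positivity
  calc _ ≤ 2 * ‖(∫ s in (0 : ℝ)..τ, g s) - τ • g (τ / 2)‖ := by
        linarith [norm_nonneg ((∫ s in (0 : ℝ)..τ, g s) - τ • g (τ / 2))]
    _ ≤ C * τ ^ 2 * τ := hbound
    _ = C * τ ^ 3 := by ring

/-- Expansion of the solution of `Ψ' = εB(s)Ψ` up to second order, with `B` frozen at the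
midpoint of `[0, τ]`. -/
theorem norm_evolution_expansion_le {B : ℝ → H →ₗ[ℂ] H} {Ψ : ℝ → H} {ε τ β K ℓ L Q : ℝ}
    (hε : 0 ≤ ε) (hε1 : ε ≤ 1) (hτ : 0 ≤ τ) (hβ : 0 ≤ β)
    (hB : ∀ s x, ‖B s x‖ ≤ β * ‖x‖) (hBc : ∀ x, Continuous fun s => B s x)
    (hBΨ : ContinuousOn (fun s => B s (Ψ s)) (Icc 0 τ)) (hK : ∀ s ∈ Icc 0 τ, ‖Ψ s‖ ≤ K)
    (hΨ : ∀ s ∈ Icc 0 τ, Ψ s - Ψ 0 = ε • ∫ σ in (0 : ℝ)..s, B σ (Ψ σ))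
    (hℓ : ∀ s ∈ Icc 0 τ, ‖B s (Ψ 0) - B (τ / 2) (Ψ 0)‖ ≤ ℓ * τ)
    (hL : ∀ s ∈ Icc 0 τ, ‖B s (B (τ / 2) (Ψ 0)) - B (τ / 2) (B (τ / 2) (Ψ 0))‖ ≤ L * τ)
    (hQ : ‖(∫ s in (0 : ℝ)..τ, B s (Ψ 0)) - τ • B (τ / 2) (Ψ 0)‖ ≤ Q * τ ^ 3) :
    ‖Ψ τ - Ψ 0 - (ε * τ) • B (τ / 2) (Ψ 0) -
        ((ε * τ) ^ 2 / 2) • B (τ / 2) (B (τ / 2) (Ψ 0))‖ ≤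
      ε * τ ^ 3 * (Q + β ^ 3 * K + β * ℓ + L) := by
  have h0 : (0 : ℝ) ∈ Icc 0 τ := left_mem_Icc.2 hτ
  have hK0 : 0 ≤ K := (norm_nonneg _).trans (hK 0 h0)
  have hsub : ∀ {s}, s ∈ Icc 0 τ → ∀ {σ}, σ ∈ uIoc 0 s → σ ∈ Icc 0 s ∧ σ ∈ Icc 0 τ := by
    intro s hs σ hσ
    rw [uIoc_of_le hs.1] at hσ
    exact ⟨⟨hσ.1.le, hσ.2⟩, hσ.1.le, hσ.2.trans hs.2⟩
  have hi : ∀ s ∈ Icc 0 τ, IntervalIntegrable (fun σ => B σ (Ψ σ)) volume 0 s := fun s hs =>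
    (hBΨ.mono (by rw [uIcc_of_le hs.1]; exact Icc_subset_Icc_right hs.2)).intervalIntegrable
  set w := B (τ / 2) (Ψ 0) with hw
  set z := B (τ / 2) w with hz
  -- Bootstrap on the integral equation: this crude bound is fed back to obtain the first order
  -- expansion `step2`, which in turn yields the second order one.
  have step1 : ∀ s ∈ Icc 0 τ, ‖Ψ s - Ψ 0‖ ≤ ε * (β * K * τ) := by
    intro s hs
    rw [hΨ s hs, norm_smul, Real.norm_of_nonneg hε]
    refine mul_le_mul_of_nonneg_left ?_ hε
    refine (intervalIntegral.norm_integral_le_of_norm_le_const (C := β * K) fun σ hσ => ?_).trans ?_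
    · exact (hB σ _).trans (mul_le_mul_of_nonneg_left (hK σ (hsub hs hσ).2) hβ)
    · rw [sub_zero, abs_of_nonneg hs.1]
      exact mul_le_mul_of_nonneg_left hs.2 (by positivity)
  have step2 : ∀ s ∈ Icc 0 τ, ‖Ψ s - Ψ 0 - (ε * s) • w‖ ≤ ε * ((β ^ 2 * K + ℓ) * τ ^ 2) := by
    intro s hs
    have hℓ0 : 0 ≤ ℓ * τ := (norm_nonneg _).trans (hℓ 0 h0)
    have heq : Ψ s - Ψ 0 - (ε * s) • w = ε • ∫ σ in (0 : ℝ)..s, (B σ (Ψ σ) - w) := by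
      rw [intervalIntegral.integral_sub (hi s hs) (continuous_const.intervalIntegrable _ _),
        intervalIntegral.integral_const, sub_zero, smul_sub, ← hΨ s hs, smul_smul]
    rw [heq, norm_smul, Real.norm_of_nonneg hε]
    refine mul_le_mul_of_nonneg_left ?_ hε
    refine (intervalIntegral.norm_integral_le_of_norm_le_const (C := (β ^ 2 * K + ℓ) * τ)
      fun σ hσ => ?_).trans ?_
    · have hσ' := (hsub hs hσ).2
      have hsplit : B σ (Ψ σ) - w = B σ (Ψ σ - Ψ 0) + (B σ (Ψ 0) - w) := by
        rw [map_sub]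
        abel
      rw [hsplit]
      refine (norm_add_le _ _).trans ?_
      have h1 := (hB σ (Ψ σ - Ψ 0)).trans (mul_le_mul_of_nonneg_left (step1 σ hσ') hβ)
      have h2 := hℓ σ hσ'
      -- Only one factor ε has to survive in the final bound; further ones are discarded here and
      -- below by ε ≤ 1.
      have h3 : β * (ε * (β * K * τ)) ≤ β * (1 * (β * K * τ)) := by gcongr
      linarith
    · rw [sub_zero, abs_of_nonneg hs.1, sq τ, ← mul_assoc _ τ τ]
      refine mul_le_mul_of_nonneg_left hs.2 ?_
      have : 0 ≤ β ^ 2 * K * τ := by positivity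
      linarith
  have hτm : τ ∈ Icc 0 τ := right_mem_Icc.2 hτ
  have hid : ∫ σ in (0 : ℝ)..τ, (ε * σ) • z = (ε * τ ^ 2 / 2) • z := by
    rw [intervalIntegral.integral_smul_const, intervalIntegral.integral_const_mul, integral_id]
    congr 1
    ring
  have hBi := (hBc (Ψ 0)).intervalIntegrable (μ := volume) 0 τ
  have hzi : IntervalIntegrable (fun σ : ℝ => (ε * σ) • z) volume 0 τ :=
    (by fun_prop : Continuous _).intervalIntegrable _ _
  -- The first integral is the second order remainder, the second summand the midpoint quadrature
  -- error. By `hid` the integral of `(ε * σ) • z` supplies the quadratic Taylor term.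
  have hmain : Ψ τ - Ψ 0 - (ε * τ) • w - ((ε * τ) ^ 2 / 2) • z =
      ε • (∫ σ in (0 : ℝ)..τ, (B σ (Ψ σ) - B σ (Ψ 0) - (ε * σ) • z)) +
        ε • ((∫ σ in (0 : ℝ)..τ, B σ (Ψ 0)) - τ • w) := by
    rw [intervalIntegral.integral_sub ((hi τ hτm).sub hBi) hzi,
      intervalIntegral.integral_sub (hi τ hτm) hBi, hid, hΨ τ hτm]
    module
  rw [hmain]
  refine (norm_add_le _ _).trans ?_
  rw [norm_smul, norm_smul, Real.norm_of_nonneg hε]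
  have hlast : ‖∫ σ in (0 : ℝ)..τ, (B σ (Ψ σ) - B σ (Ψ 0) - (ε * σ) • z)‖ ≤
      ((β ^ 3 * K + β * ℓ + L) * τ ^ 2) * |τ - 0| := by
    refine intervalIntegral.norm_integral_le_of_norm_le_const fun σ hσ => ?_
    have hσ' := (hsub hτm hσ).2
    have hsplit : B σ (Ψ σ) - B σ (Ψ 0) - (ε * σ) • z =
        B σ (Ψ σ - Ψ 0 - (ε * σ) • w) + (ε * σ) • (B σ w - z) := by
      rw [map_sub, map_sub, LinearMap.map_smul_of_tower, smul_sub]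
      abel
    rw [hsplit]
    refine (norm_add_le _ _).trans ?_
    have hn : 0 ≤ (β ^ 2 * K + ℓ) * τ ^ 2 := by
      have h1 : 0 ≤ ℓ * τ := (norm_nonneg _).trans (hℓ 0 h0)
      have h2 : 0 ≤ ℓ * τ * τ := by positivity
      have h3 : 0 ≤ β ^ 2 * K * τ ^ 2 := by positivity
      linarith
    have h1 : ‖B σ (Ψ σ - Ψ 0 - (ε * σ) • w)‖ ≤ β * ((β ^ 2 * K + ℓ) * τ ^ 2) :=
      (hB σ _).trans (mul_le_mul_of_nonneg_left
        ((step2 σ hσ').trans (mul_le_of_le_one_left hn hε1)) hβ)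
    have h2 : ‖(ε * σ) • (B σ w - z)‖ ≤ τ * (L * τ) := by
      rw [norm_smul, Real.norm_of_nonneg (mul_nonneg hε hσ'.1)]
      refine mul_le_mul ?_ (hL σ hσ') (norm_nonneg _) hτ
      exact (mul_le_of_le_one_left hσ'.1 hε1).trans hσ'.2
    linarith
  rw [sub_zero, abs_of_nonneg hτ] at hlast
  have h1 := mul_le_mul_of_nonneg_left hlast hε
  have h2 := mul_le_mul_of_nonneg_left hQ hε
  linarith

end Expansion

/-! ### The local error -/

section LocalError

variable {a b : ℝ} (hab : a < b) (P : L2 a b →L[ℂ] L2 a b)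

/-- The potential in the interaction picture, `e^{-s𝐓} P e^{s𝐓}`. -/
noncomputable def interaction (s : ℝ) : L2 a b →ₗ[ℂ] L2 a b :=
  (freeGroup hab (-s)).toLinearMap ∘ₗ P.toLinearMap ∘ₗ (freeGroup hab s).toLinearMap

theorem interaction_apply (s : ℝ) (u : L2 a b) :
    interaction hab P s u = freeGroup hab (-s) (P (freeGroup hab s u)) := rfl

/-- Isometric conjugation moves the base time `r` to `0`, so differences of the interaction operator
need to be estimated only there. -/
theorem interaction_add_apply (r s : ℝ) (u : L2 a b) : interaction hab P (r + s) u =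
    freeGroup hab (-r) (interaction hab P s (freeGroup hab r u)) := by
  rw [interaction_apply, interaction_apply, ← freeGroup_add, ← freeGroup_add, neg_add, add_comm s r]

theorem continuousOn_interaction_apply {f : ℝ → L2 a b} {s : Set ℝ} (hf : ContinuousOn f s) :
    ContinuousOn (fun σ => interaction hab P σ (f σ)) s :=
  continuousOn_freeGroup_apply hab continuousOn_neg
    (P.continuous.comp_continuousOn (continuousOn_freeGroup_apply hab continuousOn_id hf))

variable {P} {β : ℝ}

theorem norm_interaction_apply_le (hP : ∀ u, ‖P u‖ ≤ β * ‖u‖) (s : ℝ) (u : L2 a b) :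
    ‖interaction hab P s u‖ ≤ β * ‖u‖ := by
  rw [interaction_apply, LinearIsometry.norm_map]
  simpa using hP (freeGroup hab s u)

/-- Two terms arise, from moving the inner and the outer group in turn. Each costs one derivative,
the outer one after `P`, and contributes `2 * β * K * |s - r|`. -/
theorem norm_interaction_sub_le (hP : ∀ u, ‖P u‖ ≤ β * ‖u‖) (hβ : 0 ≤ β)
    (hP1 : ∀ K u, SobolevBound 1 K u → SobolevBound 1 (β * K) (P u)) {K : ℝ} {u : L2 a b}
    (hu : SobolevBound 1 K u) (r s : ℝ) :
    ‖interaction hab P s u - interaction hab P r u‖ ≤ 4 * β * K * |s - r| := by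
  have hv := hu.freeGroup hab r
  set v := freeGroup hab r u with hvdef
  set h := s - r with hh
  have e1 : interaction hab P s u = freeGroup hab (-r) (interaction hab P h v) := by
    rw [hvdef, ← interaction_add_apply, hh, add_sub_cancel]
  have e2 : interaction hab P r u = freeGroup hab (-r) (P v) := rfl
  rw [e1, e2, ← map_sub, LinearIsometry.norm_map, interaction_apply]
  have hsplit : freeGroup hab (-h) (P (freeGroup hab h v)) - P v =
      freeGroup hab (-h) (P (freeGroup hab h v - v)) + (freeGroup hab (-h) (P v) - P v) := by
    rw [map_sub, map_sub]
    abel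
  rw [hsplit]
  refine (norm_add_le _ _).trans ?_
  rw [LinearIsometry.norm_map]
  have h1 := (hP _).trans (mul_le_mul_of_nonneg_left (norm_freeGroup_sub_le hv hab h) hβ)
  have h2 := norm_freeGroup_sub_le (hP1 K v hv) hab (-h)
  rw [abs_neg] at h2
  linarith

theorem norm_interaction_second_difference_le (hP : ∀ u, ‖P u‖ ≤ β * ‖u‖) (hβ : 0 ≤ β)
    (hP1 : ∀ K u, SobolevBound 1 K u → SobolevBound 1 (β * K) (P u))
    (hP2 : ∀ K u, SobolevBound 2 K u → SobolevBound 2 (β * K) (P u)) {K : ℝ} {u : L2 a b}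
    (hu : SobolevBound 2 K u) (r s : ℝ) :
    ‖interaction hab P (r + s) u + interaction hab P (r - s) u -
      (2 : ℝ) • interaction hab P r u‖ ≤ 16 * β * K * s ^ 2 := by
  have hv := hu.freeGroup hab r
  set v := freeGroup hab r u with hvdef
  have e1 : interaction hab P (r + s) u = freeGroup hab (-r) (interaction hab P s v) :=
    interaction_add_apply hab P r s u
  have e2 : interaction hab P (r - s) u = freeGroup hab (-r) (interaction hab P (-s) v) :=
    interaction_add_apply hab P r (-s) u
  have e3 : interaction hab P r u = freeGroup hab (-r) (P v) := rfl
  have e4 : (2 : ℝ) • interaction hab P r u = freeGroup hab (-r) (P v + P v) := by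
    rw [e3, two_smul, map_add]
  rw [e1, e2, e4, ← map_add, ← map_sub, LinearIsometry.norm_map, interaction_apply,
    interaction_apply, neg_neg]
  set d := freeGroup hab s v - v with hd
  set d' := freeGroup hab (-s) v - v with hd'
  have hd1 : SobolevBound 1 (2 * |s| * K) d := hv.freeGroup_sub hab s
  have hd1' : SobolevBound 1 (2 * |s| * K) d' := by
    simpa using! hv.freeGroup_sub hab (-s)
  have e5 : freeGroup hab s v = v + d := by rw [hd]; abel
  have e6 : freeGroup hab (-s) v = v + d' := by rw [hd']; abel
  clear_value d d'
  -- A discrete Leibniz rule: second differences fall on `v` or on `P v`, and mixed terms take a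
  -- first difference on each side of `P`. Each of the four pieces contributes `4 * β * K * s ^ 2`.
  have hsplit : freeGroup hab (-s) (P (freeGroup hab s v)) + freeGroup hab s (P (freeGroup hab (-s) v))
      - (P v + P v) =
      P (freeGroup hab s v + freeGroup hab (-s) v - (2 : ℝ) • v) +
        (freeGroup hab (-s) (P d) - P d) + (freeGroup hab s (P d') - P d') +
        (freeGroup hab s (P v) + freeGroup hab (-s) (P v) - (2 : ℝ) • P v) := by
    simp only [e5, e6, two_smul, map_add, map_sub]
    abel
  rw [hsplit]
  have h1 := (hP _).trans (mul_le_mul_of_nonneg_left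
    (norm_freeGroup_second_difference_le hv hab s) hβ)
  have h2 := norm_freeGroup_sub_le (hP1 _ _ hd1) hab (-s)
  have h3 := norm_freeGroup_sub_le (hP1 _ _ hd1') hab s
  have h4 := norm_freeGroup_second_difference_le (hP2 _ _ hv) hab s
  rw [abs_neg] at h2
  have hs : |s| * |s| = s ^ 2 := by rw [← sq, sq_abs]
  have h5 : 2 * |s| * (β * (2 * |s| * K)) = 4 * β * K * s ^ 2 := by
    rw [← hs]
    ring
  rw [h5] at h2 h3
  refine (norm_add₄_le ..).trans ?_
  linarith

end LocalError

/-! ### Solutions of the Dirac equation -/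

section Solution

variable {a b : ℝ} {V A₁ : ℝ → ℝ} {P : L2 a b →L[ℂ] L2 a b}

/-- Frequency by frequency, 𝐓 becomes a matrix and the equation a linear ordinary differential
equation with forcing. -/
theorem IsDiracSolution.exists_hasDerivAt {ε S : ℝ} {Φ₀ : L2 a b} {Φ : ℝ → L2 a b} (hab : a < b)
    (hP : ∀ u, P u =ᵐ[intervalMeasure a b] fun x => act (potentialMatrix V A₁ x) (u x))
    (h : IsDiracSolution a b V A₁ ε S Φ₀ Φ) {t : ℝ} (ht : t ∈ Ioo 0 S) :
    ∃ F : L2 a b, HasDerivAt Φ F t ∧ ∀ l, coef a b l F =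
      freeGen a b l (coef a b l (Φ t)) + ε • coef a b l (P (Φ t)) := by
  obtain ⟨D, F, hD, hF, heq⟩ := h.equation t ht
  refine ⟨F, hF, fun l => ?_⟩
  have hD1 := hD.memLp 1 le_rfl
  have hderiv : fourierCoef a b (D 1) l = (Complex.I * freq a b l) • coef a b l (Φ t) := by
    rw [(hD.weakDeriv 0 one_pos).fourierCoef_eq hab (hD.continuousOn 0 one_pos)
      (hD.periodic 0 one_pos) (hD1.integrable (by norm_num)), fourierCoef_congr hD.zero, coef_apply]
  have hFeq : F = -matOp a b σ₁ hD1.toLp - Complex.I • matOp a b σ₃ (Φ t) + (ε : ℂ) • P (Φ t) := by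
    refine Lp.ext ?_
    filter_upwards [heq, hD1.coeFn_toLp, coeFn_matOp σ₁ hD1.toLp, coeFn_matOp σ₃ (Φ t), hP (Φ t),
      Lp.coeFn_add (-matOp a b σ₁ hD1.toLp - Complex.I • matOp a b σ₃ (Φ t)) ((ε : ℂ) • P (Φ t)),
      Lp.coeFn_sub (-matOp a b σ₁ hD1.toLp) (Complex.I • matOp a b σ₃ (Φ t)),
      Lp.coeFn_neg (matOp a b σ₁ hD1.toLp), Lp.coeFn_smul Complex.I (matOp a b σ₃ (Φ t)),
      Lp.coeFn_smul (ε : ℂ) (P (Φ t))] with x h1 h2 h3 h4 h5 h6 h7 h8 h9 h10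
    rw [h1, h6, Pi.add_apply, h7, Pi.sub_apply, h8, Pi.neg_apply, h9, h10, Pi.smul_apply,
      Pi.smul_apply, h3, h4, h5, h2, freeOp, act_eq_actL, act_eq_actL]
  rw [hFeq, map_add, map_sub, map_neg, map_smul, map_smul, coef_matOp, coef_matOp, coef_toLp,
    hderiv, freeGen_apply, map_smul, smul_add, smul_smul, neg_add, Complex.coe_smul,
    ← sub_eq_add_neg]

theorem hasDerivAt_exp_neg_smul_apply {E : Type*} [NormedAddCommGroup E] [InnerProductSpace ℂ E]
    [CompleteSpace E] {X : E →L[ℂ] E} {f : ℝ → E} {f' : E} {s : ℝ} (hf : HasDerivAt f f' s) :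
    HasDerivAt (fun s : ℝ => NormedSpace.exp ((-s) • X) (f s))
      (NormedSpace.exp ((-s) • X) (f' - X (f s))) s := by
  have h1 : HasDerivAt (fun s : ℝ => NormedSpace.exp ((-s) • X))
      (-(NormedSpace.exp ((-s) • X) * X)) s := by
    have := (hasDerivAt_exp_smul_const (𝕂 := ℝ) X (-s)).scomp s (hasDerivAt_neg s)
    rw [neg_one_smul] at this
    exact this
  have h2 := ((ContinuousLinearMap.restrictScalarsL ℂ E E ℝ ℝ).hasFDerivAt
    (x := NormedSpace.exp ((-s) • X))).comp_hasDerivAt s h1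
  have h3 := h2.clm_apply hf
  refine h3.congr_deriv ?_
  rw [map_sub, map_neg]
  change -(NormedSpace.exp ((-s) • X) (X (f s))) + NormedSpace.exp ((-s) • X) f' = _
  abel

/-- Duhamel's formula in the interaction picture. -/
theorem IsDiracSolution.interaction_sub_eq (hab : a < b) {ε S : ℝ} {Φ₀ : L2 a b} {Φ : ℝ → L2 a b}
    (hP : ∀ u, P u =ᵐ[intervalMeasure a b] fun x => act (potentialMatrix V A₁ x) (u x))
    (h : IsDiracSolution a b V A₁ ε S Φ₀ Φ) {t₀ s : ℝ} (ht₀ : 0 ≤ t₀) (hs : 0 ≤ s)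
    (hS : t₀ + s ≤ S) :
    freeGroup hab (-s) (Φ (t₀ + s)) - Φ t₀ = ε • ∫ σ in (0 : ℝ)..s,
      interaction hab P σ (freeGroup hab (-σ) (Φ (t₀ + σ))) := by
  have hmaps : MapsTo (fun σ => t₀ + σ) (Icc 0 s) (Icc 0 S) := fun σ hσ =>
    ⟨add_nonneg ht₀ hσ.1, (add_le_add_right hσ.2 t₀).trans hS⟩
  have hcont : ContinuousOn (fun σ => Φ (t₀ + σ)) (Icc 0 s) :=
    h.continuousOn.comp (by fun_prop) hmaps
  have hcontΨ : ContinuousOn (fun σ => freeGroup hab (-σ) (Φ (t₀ + σ))) (Icc 0 s) :=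
    continuousOn_freeGroup_apply hab continuousOn_neg hcont
  have hcontB := continuousOn_interaction_apply hab P hcontΨ
  have hint : IntervalIntegrable
      (fun σ => interaction hab P σ (freeGroup hab (-σ) (Φ (t₀ + σ)))) volume 0 s :=
    (by rwa [uIcc_of_le hs] : ContinuousOn _ (uIcc 0 s)).intervalIntegrable
  -- On a single coefficient the generator is bounded, so the product rule applies and the unbounded
  -- operator is never differentiated on `L²`. The fundamental theorem used below needs derivatives
  -- only in the open interval.
  refine ext_coef hab fun l => ?_
  have hcoef : coef a b l (∫ σ in (0 : ℝ)..s,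
      interaction hab P σ (freeGroup hab (-σ) (Φ (t₀ + σ)))) =
      ∫ σ in (0 : ℝ)..s, coef a b l (interaction hab P σ (freeGroup hab (-σ) (Φ (t₀ + σ)))) :=
    ((coef a b l).intervalIntegral_comp_comm hint).symm
  have hB : ∀ σ, interaction hab P σ (freeGroup hab (-σ) (Φ (t₀ + σ))) =
      freeGroup hab (-σ) (P (Φ (t₀ + σ))) := fun σ => by
    rw [interaction_apply, freeGroup_apply_neg]
  have hderiv : ∀ σ ∈ Ioo 0 s, HasDerivAt
      (fun σ => coef a b l (freeGroup hab (-σ) (Φ (t₀ + σ))))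
      (ε • coef a b l (interaction hab P σ (freeGroup hab (-σ) (Φ (t₀ + σ))))) σ := by
    intro σ hσ
    obtain ⟨F, hF, hFl⟩ := h.exists_hasDerivAt hab hP (t := t₀ + σ)
      ⟨by linarith [hσ.1], by linarith [hσ.2]⟩
    have h1 : HasDerivAt (fun σ => coef a b l (Φ (t₀ + σ))) (coef a b l F) σ :=
      ((((coef a b l).restrictScalars ℝ).hasFDerivAt (x := Φ (t₀ + σ))).comp_hasDerivAt σ
        (hF.comp_const_add t₀ σ) :)
    have h2 := hasDerivAt_exp_neg_smul_apply (X := freeGen a b l) h1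
    simp_rw [coef_freeGroup]
    refine h2.congr_deriv ?_
    rw [hFl, hB, coef_freeGroup, add_sub_cancel_left]
    exact ContinuousLinearMap.map_smul_of_tower _ ε _
  have hftc := intervalIntegral.integral_eq_sub_of_hasDerivAt_of_le hs
    ((coef a b l).continuous.comp_continuousOn hcontΨ) hderiv
    (((coef a b l).continuous.comp_continuousOn
      (by rwa [uIcc_of_le hs] : ContinuousOn _ (uIcc 0 s))).const_smul ε).intervalIntegrable
  rw [intervalIntegral.integral_smul, ← hcoef] at hftc
  rw [map_sub, ContinuousLinearMap.map_smul_of_tower, hftc]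
  simp [freeGroup_zero]

/-- A Sobolev bound for almost all times holds for all times. -/
theorem sobolevBound_of_ae (hab : a < b) {S M : ℝ} {m : ℕ} (hm : 2 ≤ m) (hS : 0 < S) {Φ : ℝ → L2 a b}
    (hΦ : ContinuousOn Φ (Icc 0 S))
    (h : ∀ᵐ t ∂(volume.restrict (Icc 0 S)), sobolevNorm a b m (Φ t) ≤ ENNReal.ofReal M)
    {t : ℝ} (ht : t ∈ Icc 0 S) : SobolevBound 2 (√(b - a) * max M 0) (Φ t) := by
  refine sobolevBound_two_of_sum_le hab (le_max_right _ _) fun s => ?_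
  -- Finite partial sums are continuous along an `L²`-continuous curve, which the full Sobolev norm
  -- need not be.
  set g : ℝ → ℝ := fun t => ∑ l ∈ s, (1 + freq a b l ^ 2) ^ 2 * ‖coef a b l (Φ t)‖ ^ 2 with hg
  have hgc : ContinuousOn g (Icc 0 S) := by
    refine continuousOn_finsetSum s fun l _ => ContinuousOn.mul continuousOn_const ?_
    exact ((coef a b l).continuous.comp_continuousOn hΦ).norm.pow 2
  -- The inequality is rewritten as an equality of continuous functions, because such an equality
  -- extends from almost every point to all of the interval.
  have hae : (fun t => max (g t) (max M 0 ^ 2)) =ᵐ[volume.restrict (Icc 0 S)]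
      fun _ => max M 0 ^ 2 := by
    filter_upwards [h] with t ht
    refine max_eq_right ?_
    have hsq := pow_le_pow_left' ht 2
    rw [sobolevNorm, ← ENNReal.rpow_natCast (_ ^ (1 / 2 : ℝ)) 2, ← ENNReal.rpow_mul,
      show (1 / 2 : ℝ) * ((2 : ℕ) : ℝ) = 1 by norm_num, ENNReal.rpow_one] at hsq
    have hM : ENNReal.ofReal M ^ 2 = ENNReal.ofReal (max M 0 ^ 2) := by
      rw [ENNReal.ofReal_pow (le_max_right _ _), ENNReal.ofReal_max, ENNReal.ofReal_zero,
        max_eq_left zero_le]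
    rw [← ENNReal.ofReal_le_ofReal_iff (by positivity), ← hM, hg,
      ENNReal.ofReal_sum_of_nonneg fun l _ => by positivity]
    refine ((Finset.sum_le_sum fun l _ => ?_).trans (ENNReal.sum_le_tsum s)).trans hsq
    rw [coef_apply]
    refine ENNReal.ofReal_le_ofReal (mul_le_mul_of_nonneg_right ?_ (by positivity))
    exact pow_le_pow_right₀ (by nlinarith [sq_nonneg (freq a b l)]) hm
  have := Measure.eqOn_Icc_of_ae_eq volume hS.ne hae (hgc.sup continuousOn_const)
    continuousOn_const ht
  exact max_eq_right_iff.1 this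

end Solution

/-! ### Strang splitting -/

section Strang

variable {a b : ℝ} (hab : a < b) {V A₁ : ℝ → ℝ}
  (hV : AEStronglyMeasurable V (intervalMeasure a b))
  (hA₁ : AEStronglyMeasurable A₁ (intervalMeasure a b))

/-- One step of the Strang splitting as a map of `(L²(a, b))²`. -/
noncomputable def strangOp (ε τ : ℝ) (u : L2 a b) : L2 a b :=
  freeGroup hab (τ / 2) (potentialGroup hV hA₁ (ε * τ) (freeGroup hab (τ / 2) u))

theorem freeGroup_smul (hab : a < b) (t r : ℝ) (u : L2 a b) :
    freeGroup hab t (r • u) = r • freeGroup hab t u :=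
  (freeGroup hab t).toLinearMap.map_smul_of_tower r u

theorem strangStep_eq (ε τ : ℝ) {f : ℝ → Spinor} {u : L2 a b}
    (hf : f =ᵐ[intervalMeasure a b] u) :
    strangStep a b V A₁ ε τ f = strangOp hab hV hA₁ ε τ u := by
  rw [strangStep, freeFlow_eq_freeGroup hab _ hf]
  exact freeFlow_eq_freeGroup hab _ (MemLp.coeFn_toLp _).symm

/-- All three factors of a step are non-expansive. This is stability with constant one, so no
exponential growth in time appears. -/
theorem norm_strangOp_sub_le (ε τ : ℝ) (u v : L2 a b) :
    ‖strangOp hab hV hA₁ ε τ u - strangOp hab hV hA₁ ε τ v‖ ≤ ‖u - v‖ := by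
  rw [strangOp, strangOp, ← map_sub, LinearIsometry.norm_map]
  refine (norm_potentialGroup_sub_le hV hA₁ _ _ _).trans ?_
  rw [← map_sub, LinearIsometry.norm_map]

/-- The numerical approximation as a sequence in `(L²(a, b))²`. -/
noncomputable def strangSeq (ε τ : ℝ) (u : L2 a b) (n : ℕ) : L2 a b :=
  (strangOp hab hV hA₁ ε τ)^[n] u

theorem strangApprox_ae_eq (ε τ : ℝ) (u : L2 a b) (n : ℕ) :
    strangApprox a b V A₁ ε τ u n =ᵐ[intervalMeasure a b] strangSeq hab hV hA₁ ε τ u n := by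
  induction n with
  | zero => rfl
  | succ n ih =>
    rw [strangApprox, strangStep_eq hab hV hA₁ ε τ ih, strangSeq, strangSeq,
      Function.iterate_succ_apply']

variable {P : L2 a b →L[ℂ] L2 a b} {β : ℝ}

/-- The local error of the Strang splitting. -/
theorem norm_sub_strangOp_le
    (hP : ∀ u, P u =ᵐ[intervalMeasure a b] fun x => act (potentialMatrix V A₁ x) (u x))
    (hβ : 0 ≤ β) (hPb : ∀ k ≤ 2, ∀ K u, SobolevBound k K u → SobolevBound k (β * K) (P u))
    {ε S K : ℝ} (hε : 0 ≤ ε) (hε1 : ε ≤ 1) {Φ₀ : L2 a b} {Φ : ℝ → L2 a b}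
    (h : IsDiracSolution a b V A₁ ε S Φ₀ Φ) (hΦ : ∀ t ∈ Icc 0 S, SobolevBound 2 K (Φ t))
    {t τ : ℝ} (ht : 0 ≤ t) (hτ : 0 ≤ τ) (hS : t + τ ≤ S) :
    ‖Φ (t + τ) - strangOp hab hV hA₁ ε τ (Φ t)‖ ≤
      ε * τ ^ 3 * ((16 * β + 8 * β ^ 2 + 2 * β ^ 3) * K) := by
  have hP0 : ∀ u, ‖P u‖ ≤ β * ‖u‖ := fun u => hPb 0 (by norm_num) ‖u‖ u (le_refl ‖u‖)
  have hP1 := hPb 1 (by norm_num)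
  have hP2 := hPb 2 le_rfl
  set Ψ : ℝ → L2 a b := fun s => freeGroup hab (-s) (Φ (t + s)) with hΨdef
  have hΨ0 : Ψ 0 = Φ t := by simp [hΨdef, freeGroup_zero]
  have hmem : ∀ s ∈ Icc 0 τ, t + s ∈ Icc 0 S := fun s hs =>
    ⟨add_nonneg ht hs.1, (add_le_add_right hs.2 t).trans hS⟩
  have hb0 : SobolevBound 2 K (Ψ 0) := by
    rw [hΨ0]
    exact hΦ t ⟨ht, by linarith⟩
  have hK : 0 ≤ K := hb0.nonneg
  have hmid : ∀ s ∈ Icc 0 τ, |s - τ / 2| ≤ τ := fun s hs => by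
    rw [abs_le]
    constructor <;> linarith [hs.1, hs.2]
  have hΨc : ContinuousOn Ψ (Icc 0 τ) := continuousOn_freeGroup_apply hab continuousOn_neg
    (h.continuousOn.comp (by fun_prop) hmem)
  have hBc : ∀ x, Continuous fun s => interaction hab P s x := fun x =>
    continuousOn_univ.1 (continuousOn_interaction_apply hab P continuousOn_const)
  have hw : SobolevBound 1 (β * K) (interaction hab P (τ / 2) (Ψ 0)) :=
    (hP1 _ _ (hb0.of_succ.freeGroup hab _)).freeGroup hab _
  -- `ℓ` and `L` are Lipschitz constants of the interaction operator on `Ψ 0` and on its midpoint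
  -- image, which needs only one derivative; `Q` comes from the second differences.
  have hexact := norm_evolution_expansion_le (B := interaction hab P) (Ψ := Ψ) (τ := τ) (K := K)
    (ℓ := 4 * β * K) (L := 4 * β * (β * K)) (Q := 16 * β * K) hε hε1 hτ hβ
    (norm_interaction_apply_le hab hP0) hBc (continuousOn_interaction_apply hab P hΨc)
    (fun s hs => ((hΦ _ (hmem s hs)).freeGroup hab (-s)).norm_le)
    (fun s hs => by
      rw [hΨ0]
      exact h.interaction_sub_eq hab hP ht hs.1 (hmem s hs).2)
    (fun s hs => (norm_interaction_sub_le hab hP0 hβ hP1 hb0.of_succ (τ / 2) s).trans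
      (mul_le_mul_of_nonneg_left (hmid s hs) (by positivity)))
    (fun s hs => (norm_interaction_sub_le hab hP0 hβ hP1 hw (τ / 2) s).trans
      (mul_le_mul_of_nonneg_left (hmid s hs) (by positivity)))
    (norm_integral_sub_midpoint_le (hBc _) hτ (by positivity) fun s =>
      norm_interaction_second_difference_le hab hP0 hβ hP1 hP2 hb0 (τ / 2) s)
  have hnum := norm_potentialGroup_taylor_le hV hA₁ hP (mul_nonneg hε hτ)
    (freeGroup hab (τ / 2) (Ψ 0))
  set v := freeGroup hab (τ / 2) (Ψ 0) with hv
  have hB1 : interaction hab P (τ / 2) (Ψ 0) = freeGroup hab (-(τ / 2)) (P v) := rfl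
  have hB2 : interaction hab P (τ / 2) (interaction hab P (τ / 2) (Ψ 0)) =
      freeGroup hab (-(τ / 2)) (P (P v)) := by
    rw [hB1, interaction_apply, freeGroup_apply_neg]
  have hτΨ : Φ (t + τ) = freeGroup hab (τ / 2) (freeGroup hab (τ / 2) (Ψ τ)) := by
    rw [← freeGroup_add, add_halves, hΨdef]
    exact (freeGroup_apply_neg hab τ _).symm
  have hvn : ‖v‖ ≤ K := (hb0.freeGroup hab (τ / 2)).norm_le
  -- Conjugating by e^{τ𝐓/2} turns the midpoint interaction operator into `P`, so both second order
  -- expansions have the same Taylor terms and only their remainders are left.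
  have hsplit : Φ (t + τ) - strangOp hab hV hA₁ ε τ (Φ t) =
      freeGroup hab (τ / 2) (freeGroup hab (τ / 2) (Ψ τ - Ψ 0 -
        (ε * τ) • interaction hab P (τ / 2) (Ψ 0) - ((ε * τ) ^ 2 / 2) •
          interaction hab P (τ / 2) (interaction hab P (τ / 2) (Ψ 0))) -
        (potentialGroup hV hA₁ (ε * τ) v - v - (ε * τ) • P v - ((ε * τ) ^ 2 / 2) • P (P v))) := by
    rw [hτΨ, strangOp, ← hΨ0, ← hv, ← map_sub, hB2, hB1]
    congr 1
    rw [map_sub, map_sub, map_sub, ← hv, freeGroup_smul, freeGroup_smul, freeGroup_apply_neg,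
      freeGroup_apply_neg]
    abel
  rw [hsplit, LinearIsometry.norm_map]
  have h3 : (ε * τ) ^ 3 * ‖P (P (P v))‖ ≤ ε * τ ^ 3 * (β ^ 3 * K) := by
    have h4 : ‖P (P (P v))‖ ≤ β ^ 3 * K := by
      calc ‖P (P (P v))‖ ≤ β * (β * (β * K)) := by
            refine (hP0 _).trans (mul_le_mul_of_nonneg_left ?_ hβ)
            refine (hP0 _).trans (mul_le_mul_of_nonneg_left ?_ hβ)
            exact (hP0 _).trans (mul_le_mul_of_nonneg_left hvn hβ)
        _ = β ^ 3 * K := by ring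
    have h5 : (ε * τ) ^ 3 ≤ ε * τ ^ 3 := by
      rw [mul_pow]
      exact mul_le_mul_of_nonneg_right (pow_le_of_le_one hε hε1 (by norm_num)) (by positivity)
    exact mul_le_mul h5 h4 (norm_nonneg _) (by positivity)
  refine (norm_sub_le _ _).trans ?_
  rw [LinearIsometry.norm_map]
  refine (add_le_add hexact (hnum.trans h3)).trans (le_of_eq ?_)
  ring

/-- The global error of the Strang splitting. -/
theorem norm_sub_strangSeq_le
    (hP : ∀ u, P u =ᵐ[intervalMeasure a b] fun x => act (potentialMatrix V A₁ x) (u x))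
    (hβ : 0 ≤ β) (hPb : ∀ k ≤ 2, ∀ K u, SobolevBound k K u → SobolevBound k (β * K) (P u))
    {ε S K : ℝ} (hε : 0 ≤ ε) (hε1 : ε ≤ 1) {Φ₀ : L2 a b} {Φ : ℝ → L2 a b}
    (h : IsDiracSolution a b V A₁ ε S Φ₀ Φ) (hΦ : ∀ t ∈ Icc 0 S, SobolevBound 2 K (Φ t))
    {τ : ℝ} (hτ : 0 ≤ τ) (n : ℕ) (hn : n * τ ≤ S) :
    ‖Φ (n * τ) - strangSeq hab hV hA₁ ε τ Φ₀ n‖ ≤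
      n * (ε * τ ^ 3 * ((16 * β + 8 * β ^ 2 + 2 * β ^ 3) * K)) := by
  induction n with
  | zero => simp [strangSeq, h.initial]
  | succ n ih =>
    have hn' : n * τ + τ ≤ S := by
      push_cast at hn
      linarith
    have hloc := norm_sub_strangOp_le hab hV hA₁ hP hβ hPb hε hε1 h hΦ (t := n * τ)
      (by positivity) hτ hn'
    have hstab := norm_strangOp_sub_le hab hV hA₁ ε τ (Φ (n * τ)) (strangSeq hab hV hA₁ ε τ Φ₀ n)
    have hprev := ih (by linarith)
    rw [strangSeq, Function.iterate_succ_apply', ← strangSeq]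
    push_cast
    rw [add_mul, one_mul, add_mul, one_mul]
    -- The intermediate point is one numerical step started from the exact solution: local error on
    -- one side, propagated error on the other.
    refine (norm_sub_le_norm_sub_add_norm_sub _ (strangOp hab hV hA₁ ε τ (Φ (n * τ))) _).trans ?_
    linarith

end Strang

theorem MemPeriodicSobolev.aestronglyMeasurable {a b : ℝ} {m : ℕ} {p : ℝ≥0∞} {u : ℝ → ℝ}
    (h : MemPeriodicSobolev a b m p u) : AEStronglyMeasurable u (intervalMeasure a b) := by
  obtain ⟨D, hD⟩ := h
  exact (hD.memLp 0 (Nat.zero_le m)).aestronglyMeasurable.congr hD.zero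

end DiracSplitting

theorem theorem3p1 (a b : ℝ) (hab : a < b) (m : ℕ) (hm : 2 ≤ m) (V A₁ : ℝ → ℝ)
    (hV : MemPeriodicSobolev a b m ∞ V) (hA₁ : MemPeriodicSobolev a b m ∞ A₁) (M : ℝ) :
    ∃ C₁ : ℝ, 0 < C₁ ∧
      ∀ (T : ℝ), 0 < T → ∀ (ε : ℝ), 0 < ε → ε ≤ 1 →
      ∀ (Φ₀ : L2 a b) (Φ : ℝ → L2 a b), IsDiracSolution a b V A₁ ε (T / ε) Φ₀ Φ →
        (∀ᵐ t ∂(volume.restrict (Icc 0 (T / ε))),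
          MemPeriodicSobolev a b m 2 (Φ t) ∧ sobolevNorm a b m (Φ t) ≤ ENNReal.ofReal M) →
      ∀ (τ : ℝ), 0 < τ → ∀ (n : ℕ), (n : ℝ) ≤ (T / ε) / τ →
        eLpNorm (fun x => Φ (n * τ) x - strangApprox a b V A₁ ε τ Φ₀ n x) 2 (intervalMeasure a b)
            ≤ ENNReal.ofReal (C₁ * ε * (n * τ) * τ ^ 2) ∧
          C₁ * ε * (n * τ) * τ ^ 2 ≤ C₁ * T * τ ^ 2 := by
  obtain ⟨P, β, hβ, hP, hPb⟩ := exists_potentialOp hab hm hV hA₁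
  have hVm := hV.aestronglyMeasurable
  have hAm := hA₁.aestronglyMeasurable
  set K := √(b - a) * max M 0 with hKdef
  have hK : 0 ≤ K := mul_nonneg (Real.sqrt_nonneg _) (le_max_right _ _)
  set C := (16 * β + 8 * β ^ 2 + 2 * β ^ 3) * K with hC
  have hC0 : 0 ≤ C := by positivity
  -- `C` may vanish, for instance when `M ≤ 0`; adding one makes the constant positive.
  refine ⟨C + 1, by positivity, fun T hT ε hε hε1 Φ₀ Φ hΦ hreg τ hτ n hn => ⟨?_, ?_⟩⟩
  · have hS : 0 < T / ε := by positivity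
    have hbd : ∀ t ∈ Icc 0 (T / ε), SobolevBound 2 K (Φ t) := fun t ht =>
      sobolevBound_of_ae hab hm hS hΦ.continuousOn (hreg.mono fun t h => h.2) ht
    have hglob := norm_sub_strangSeq_le hab hVm hAm hP hβ hPb hε.le hε1 hΦ hbd hτ.le n
      ((le_div_iff₀ hτ).1 hn)
    have heq : (fun x => Φ (n * τ) x - strangApprox a b V A₁ ε τ Φ₀ n x) =ᵐ[intervalMeasure a b]
        (Φ (n * τ) - strangSeq hab hVm hAm ε τ Φ₀ n : L2 a b) := by
      filter_upwards [Lp.coeFn_sub (Φ (n * τ)) (strangSeq hab hVm hAm ε τ Φ₀ n),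
        strangApprox_ae_eq hab hVm hAm ε τ Φ₀ n] with x h1 h2
      rw [h1, h2, Pi.sub_apply]
    rw [eLpNorm_congr_ae heq, ← Lp.enorm_def, ← ofReal_norm]
    refine ENNReal.ofReal_le_ofReal (hglob.trans ?_)
    have hp : 0 ≤ n * (ε * τ ^ 3) := by positivity
    linarith
  · have h1 : ε * (n * τ) ≤ T := by
      have := (le_div_iff₀ hτ).1 hn
      rwa [le_div_iff₀ hε, mul_comm] at this
    have h2 : 0 ≤ (C + 1) * τ ^ 2 := by positivity
    have := mul_le_mul_of_nonneg_left h1 h2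
    linarith
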